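/- Let $\beta\in L^1(\mathbb R)$ be real-valued with distributional derivative $\beta'=\mu$ a finite signed Borel measure on $\mathbb R$. Let $s>\frac12$, and let $f\in C^{[s]+1}(\mathbb R)$ be real-valued with $f(0)=0$, where $[s]$ is the largest integer not exceeding $s$. Let $\varphi\in H^s(\mathbb R)$, where $H^s=H^s(\mathbb R)$ is the usual $L^2$-based Sobolev space of real-valued functions. Then there is $T>0$ such that the Cauchy problem $$u_t+(\beta*f(u))_x=0,\qquad u(0)=\varphi,\qquad (\beta*v)(x)=\int_{\mathbb R}\beta(x-y)v(y)\,dy,$$ is locally well-posed on $[0,T]$ with solution $u\in C^1([0,T],H^s)$; that is, there is a neighbourhood $U$ of $\varphi$ in $H^s$ such that 1. (existence) for every $\psi\in U$ there is $u^\psi\in C^1([0,T],H^s)$ with $u^\psi(0)=\psi$ and $u^\psi_t(t)=-(\beta*f(u^\psi(t)))_x$ for all $t\in[0,T]$, where $u_t$ is the derivative of the $H^s$-valued curve (one-sided at the end points) and $(\cdot)_x$ is the derivative in the sense of distributions; 2. (uniqueness) for every $\psi\in U$ and $0<T'\le T$, every solution in $C^1([0,T'],H^s)$ with initial datum $\psi$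 coincides with $u^\psi$ on $[0,T']$; 3. (continuous dependence) the map $\psi\mapsto u^\psi$ is continuous from $U\subset H^s$ to $C^1([0,T],H^s)$ with the norm $\sup_{[0,T]}\|u\|_{H^s}+\sup_{[0,T]}\|u_t\|_{H^s}$. -/

import Mathlib

open MeasureTheory Set
open scoped ContDiff SchwartzMap Convolution

noncomputable section

/-- The tempered distribution on the line given by a real-valued square-integrable function. -/
def realL2ToTempered : Lp ℝ 2 (volume : Measure ℝ) →ₗ[ℝ] 𝓢'(ℝ, ℂ) :=
  ((Lp.toTemperedDistributionCLM ℂ (volume : Measure ℝ) 2 : _ →ₗ[ℂ] _).restrictScalars ℝ) ∘ₗ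
    (Complex.ofRealCLM.compLpL 2 (volume : Measure ℝ) :
      Lp ℝ 2 (volume : Measure ℝ) →ₗ[ℝ] Lp ℂ 2 (volume : Measure ℝ))

theorem tempered_injective :
    Function.Injective (Lp.toTemperedDistributionCLM ℂ (volume : Measure ℝ) 2) :=
  LinearMap.ker_eq_bot.mp Lp.ker_toTemperedDistributionCLM_eq_bot

theorem realL2ToTempered_injective : Function.Injective realL2ToTempered := by
  intro u v h
  have h1 := tempered_injective h
  apply Lp.ext
  have hu := Complex.ofRealCLM.coeFn_compLp u
  have hv := Complex.ofRealCLM.coeFn_compLp v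
  have h2 : Complex.ofRealCLM.compLp u = Complex.ofRealCLM.compLp v := h1
  rw [h2] at hu
  filter_upwards [hu, hv] with x hx hy
  rw [hx] at hy
  exact Complex.ofReal_injective hy

/-- The real-valued `L²` functions on the line lying in the Sobolev space of order `s`. -/
def sobolevSubmodule (s : ℝ) : Submodule ℝ (Lp ℝ 2 (volume : Measure ℝ)) where
  carrier := {u | TemperedDistribution.MemSobolev s 2 (realL2ToTempered u)}
  zero_mem' := by
    change TemperedDistribution.MemSobolev s 2 (realL2ToTempered 0)
    rw [map_zero]
    exact TemperedDistribution.memSobolev_fun_zero ℝ ℂ s 2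
  add_mem' {u v} hu hv := by
    change TemperedDistribution.MemSobolev s 2 (realL2ToTempered (u + v))
    rw [map_add]
    exact TemperedDistribution.MemSobolev.add hu hv
  smul_mem' c u hu := by
    change TemperedDistribution.MemSobolev s 2 (realL2ToTempered (c • u))
    rw [map_smul]
    exact TemperedDistribution.MemSobolev.smul (c : ℂ) hu

/-- For `s ≥ 0`, the usual space `H^s(ℝ)` of real-valued functions (modulo equality almost
everywhere), consisting of those `u ∈ L²(ℝ)` for which `(1 + |ξ|²)^(s/2) û(ξ)` is square-integrable.
It carries the `H^s` norm defined below, not the `L²` norm. -/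
def SobolevH (s : ℝ) : Type := sobolevSubmodule s

namespace SobolevH

variable {s : ℝ}

instance : AddCommGroup (SobolevH s) := inferInstanceAs (AddCommGroup (sobolevSubmodule s))

instance : Module ℝ (SobolevH s) := inferInstanceAs (Module ℝ (sobolevSubmodule s))

/-- The underlying square-integrable function. -/
def toL2 : SobolevH s →ₗ[ℝ] Lp ℝ 2 (volume : Measure ℝ) := (sobolevSubmodule s).subtype

/-- An element of `H^s` is used as a function through its `L²` representative. -/
instance : CoeFun (SobolevH s) fun _ => ℝ → ℝ := ⟨fun u => (toL2 u : ℝ → ℝ)⟩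

/-- The `L²` function which represents the Bessel potential of `u`, that is, the inverse Fourier
transform of `(1 + |ξ|²)^(s/2) û(ξ)`. -/
def bessel (u : SobolevH s) : Lp ℂ 2 (volume : Measure ℝ) :=
  Classical.choose (u.2 : TemperedDistribution.MemSobolev s 2 (realL2ToTempered u.1))

theorem bessel_spec (u : SobolevH s) :
    TemperedDistribution.besselPotential ℝ ℂ s (realL2ToTempered (toL2 u)) =
      Lp.toTemperedDistributionCLM ℂ (volume : Measure ℝ) 2 (bessel u) :=
  Classical.choose_spec (u.2 : TemperedDistribution.MemSobolev s 2 (realL2ToTempered u.1))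

/-- `bessel` as a linear map. -/
def besselₗ : SobolevH s →ₗ[ℝ] Lp ℂ 2 (volume : Measure ℝ) where
  toFun := bessel
  map_add' u v := tempered_injective (by
    rw [map_add, ← bessel_spec, ← bessel_spec, ← bessel_spec, map_add, map_add, map_add])
  map_smul' c u := tempered_injective (by
    have h1 := (Lp.toTemperedDistributionCLM ℂ (volume : Measure ℝ) 2).map_smul
      (c : ℂ) (bessel u)
    have h2 := (TemperedDistribution.besselPotential ℝ ℂ s).map_smul
      (c : ℂ) (realL2ToTempered (toL2 u))
    rw [← bessel_spec] at h1 ⊢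
    rw [map_smul, map_smul]
    exact h2.trans h1.symm)

theorem besselₗ_injective : Function.Injective (besselₗ : SobolevH s →ₗ[ℝ] _) := by
  intro u v h
  have h1 : TemperedDistribution.besselPotential ℝ ℂ s (realL2ToTempered (toL2 u)) =
      TemperedDistribution.besselPotential ℝ ℂ s (realL2ToTempered (toL2 v)) := by
    rw [bessel_spec, bessel_spec]
    exact congrArg _ h
  have h2 := congrArg (TemperedDistribution.besselPotential ℝ ℂ (-s)) h1
  simp only [TemperedDistribution.besselPotential_besselPotential_apply, add_neg_cancel,
    TemperedDistribution.besselPotential_zero, ContinuousLinearMap.id_apply] at h2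
  exact Subtype.ext (realL2ToTempered_injective h2)

/-- The `H^s` norm: by Plancherel, `‖u‖` is the `L²` norm of `(1 + |ξ|²)^(s/2) û(ξ)`. -/
instance : NormedAddCommGroup (SobolevH s) :=
  NormedAddCommGroup.induced _ _ (besselₗ : SobolevH s →ₗ[ℝ] Lp ℂ 2 (volume : Measure ℝ))
    besselₗ_injective

instance : NormedSpace ℝ (SobolevH s) :=
  NormedSpace.induced ℝ _ _ (besselₗ : SobolevH s →ₗ[ℝ] Lp ℂ 2 (volume : Measure ℝ))

end SobolevH

/-- `g` is the derivative of `v` on the line in the sense of distributions. -/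
def HasWeakDeriv (v g : ℝ → ℝ) : Prop :=
  LocallyIntegrable v ∧ LocallyIntegrable g ∧
    ∀ θ : ℝ → ℝ, ContDiff ℝ ∞ θ → HasCompactSupport θ →
      ∫ x, v x * deriv θ x = -∫ x, g x * θ x

/-- The distributional derivative of the function `b` is the finite signed Borel measure `μ`
(the integral against `μ` is written by means of its Jordan decomposition). -/
def HasMeasureDeriv (b : ℝ → ℝ) (μ : SignedMeasure ℝ) : Prop :=
  LocallyIntegrable b ∧
    ∀ θ : ℝ → ℝ, ContDiff ℝ ∞ θ → HasCompactSupport θ →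
      ∫ x, b x * deriv θ x =
        -((∫ x, θ x ∂μ.toJordanDecomposition.posPart) -
          ∫ x, θ x ∂μ.toJordanDecomposition.negPart)

/-- `u ∈ C¹([0,T], H^s)` solves `u_t + (β ∗ f(u))_x = 0` on `[0,T]` with `u(0) = φ`: the time
derivative is the derivative of the curve `u` in `H^s` (one-sided at the end points), the space
derivative is taken in the sense of distributions, for every `t ∈ [0,T]`. -/
structure IsSolution (β f : ℝ → ℝ) {s : ℝ} (T : ℝ) (φ : SobolevH s) (u : ℝ → SobolevH s) :
    Prop where
  contDiffOn : ContDiffOn ℝ 1 u (Icc 0 T)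
  initial : u 0 = φ
  equation : ∀ t ∈ Icc 0 T,
    HasWeakDeriv (β ⋆[ContinuousLinearMap.mul ℝ ℝ, volume] fun y => f (u t y))
      (fun x => -(derivWithin u (Icc 0 T) t) x)

/-- The initial-value problem `u_t + (β ∗ f(u))_x = 0`, `u(0) = φ`, is well-posed in
`C¹([0,T], H^s)`: for all initial data in a neighbourhood of `φ` there is a solution on `[0,T]`,
it is unique (on `[0,T]` and on every shorter interval), and it depends continuously on the initial
datum, as a map from `H^s` to `C¹([0,T], H^s)` with the norm
`sup ‖u(t)‖ + sup ‖u'(t)‖` over `t ∈ [0,T]`. -/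
def WellPosedOn (β f : ℝ → ℝ) {s : ℝ} (T : ℝ) (φ : SobolevH s) : Prop :=
  ∃ r > 0, ∃ S : SobolevH s → ℝ → SobolevH s,
    (∀ ψ ∈ Metric.ball φ r, IsSolution β f T ψ (S ψ)) ∧
    (∀ ψ ∈ Metric.ball φ r, ∀ T', 0 < T' → T' ≤ T → ∀ v : ℝ → SobolevH s,
      IsSolution β f T' ψ v → EqOn v (S ψ) (Icc 0 T')) ∧
    (∀ ψ ∈ Metric.ball φ r, ∀ ε > 0, ∃ δ > 0, ∀ χ ∈ Metric.ball φ r, ‖χ - ψ‖ < δ →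
      ∀ t ∈ Icc 0 T, ‖S χ t - S ψ t‖ < ε ∧
        ‖derivWithin (S χ) (Icc 0 T) t - derivWithin (S ψ) (Icc 0 T) t‖ < ε)

end

/-!
Every solution of the equation solves the ordinary differential equation `u' = -μ ∗ f(u)` in
`H^s`, where `μ = β'` and the convolution with `μ` is an average of translations, hence bounded on
`H^s` and on `L²`. So everything rests on the superposition operator `u ↦ f(u)`.
With only `⌊s⌋ + 1` derivatives of `f` it need not be locally Lipschitz on `H^s`; but on bounded
subsets of `H^s` it satisfies, for every `ε > 0`,
`‖f(u) - f(v)‖_s ≤ L (‖u - v‖_s + ε) + C_ε ‖u - v‖_{L²}` with `L` independent of `ε`, and it is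
Lipschitz for the `L²` norm. For `s < 1` the first estimate is read off the Gagliardo form of the
`H^s` norm; for `s ≥ 1` it follows by induction on `⌊s⌋` from `f(u)' = f'(u) u'` and the product
estimate `‖g h‖_b ≤ C ‖g‖_a ‖h‖_b`, valid for `0 ≤ b ≤ a` and `1/2 < a`.

On a short time interval the Picard map inherits the two estimates, with a constant `< 1`. Its
iterates converge first uniformly in `L²` and then, by the first estimate, uniformly in `H^s`; the
same two-step argument gives the continuous dependence on the initial datum.
-/

open FourierTransform Filter Topology
open ContinuousLinearMap (mul)
open scoped NNReal ENNReal

noncomputable section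

/-! ### The Sobolev norm on the Fourier side -/

/-- The real-valued square-integrable functions on the line. -/
abbrev RealL2 := Lp ℝ 2 (volume : Measure ℝ)

/-- The complex-valued square-integrable functions on the line. -/
abbrev ComplexL2 := Lp ℂ 2 (volume : Measure ℝ)

/-- The complexification of a real square-integrable function. -/
def complexify : RealL2 →L[ℝ] ComplexL2 := Complex.ofRealCLM.compLpL 2 volume

theorem coeFn_complexify (w : RealL2) : complexify w =ᵐ[volume] fun x => (w x : ℂ) :=
  Complex.ofRealCLM.coeFn_compLpL w

theorem norm_complexify (w : RealL2) : ‖complexify w‖ = ‖w‖ := by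
  rw [Lp.norm_def, Lp.norm_def]
  congr 1
  apply eLpNorm_congr_norm_ae
  filter_upwards [coeFn_complexify w] with x hx
  rw [hx, Complex.norm_real]

/-- The Fourier transform of a real square-integrable function, in the normalization
`∫ exp (-2πixξ) w(x) dx`. -/
def fourierL2 : RealL2 →L[ℝ] ComplexL2 :=
  ((Lp.fourierTransformₗᵢ ℝ ℂ).toContinuousLinearEquiv.toContinuousLinearMap.restrictScalars ℝ) ∘L
    complexify

theorem fourierL2_apply (w : RealL2) : fourierL2 w = 𝓕 (complexify w) := rfl

theorem norm_fourierL2 (w : RealL2) : ‖fourierL2 w‖ = ‖w‖ := by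
  rw [fourierL2_apply, Lp.norm_fourier_eq, norm_complexify]

@[fun_prop]
theorem measurable_fourierL2 (w : RealL2) : Measurable (fourierL2 w) :=
  (Lp.stronglyMeasurable _).measurable

theorem locallyIntegrable_coeFn_L2 {E : Type*} [NormedAddCommGroup E]
    (w : Lp E 2 (volume : Measure ℝ)) : LocallyIntegrable w :=
  (Lp.memLp w).locallyIntegrable (by norm_num)

theorem ae_eq_of_integral_test_mul_eq {F G : ℝ → ℂ} (hF : LocallyIntegrable F)
    (hG : LocallyIntegrable G) (h : ∀ θ : ℝ → ℂ, ContDiff ℝ ∞ θ → HasCompactSupport θ →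
      ∫ x, θ x * F x = ∫ x, θ x * G x) :
    F =ᵐ[volume] G := by
  refine ae_eq_of_integral_contDiff_smul_eq hF hG fun g hg hg' => ?_
  simpa using h (Complex.ofRealCLM ∘ g) (by fun_prop) (hg'.comp_left rfl)

theorem integral_mul_fourierL2 (w : RealL2) (θ : 𝓢(ℝ, ℂ)) :
    ∫ ξ, θ ξ * fourierL2 w ξ = ∫ x, 𝓕 (θ : ℝ → ℂ) x * w x := by
  have h := DFunLike.congr_fun (Lp.fourier_toTemperedDistribution_eq (complexify w)) θ
  rw [TemperedDistribution.fourier_apply, Lp.toTemperedDistribution_apply,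
    Lp.toTemperedDistribution_apply] at h
  simp only [SchwartzMap.fourier_coe, smul_eq_mul] at h
  rw [fourierL2_apply, ← h]
  refine integral_congr_ae ?_
  filter_upwards [coeFn_complexify w] with x hx
  rw [hx]

/-- The squared Fourier weight `(1 + ξ²)^s` of the `H^s` norm. -/
def sobolevWeight (s ξ : ℝ) : ℝ≥0∞ := ENNReal.ofReal ((1 + ξ ^ 2) ^ s)

theorem continuous_one_add_sq_rpow (s : ℝ) : Continuous fun ξ : ℝ => (1 + ξ ^ 2) ^ s :=
  (by fun_prop : Continuous fun ξ : ℝ => 1 + ξ ^ 2).rpow_const fun _ => Or.inl (by positivity)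

@[fun_prop]
theorem measurable_sobolevWeight (s : ℝ) : Measurable (sobolevWeight s) :=
  (continuous_one_add_sq_rpow s).measurable.ennreal_ofReal

theorem sobolevWeight_mul (s t ξ : ℝ) :
    sobolevWeight s ξ * sobolevWeight t ξ = sobolevWeight (s + t) ξ := by
  rw [sobolevWeight, sobolevWeight, sobolevWeight, ← ENNReal.ofReal_mul (by positivity),
    Real.rpow_add (by positivity)]

theorem sobolevWeight_zero : sobolevWeight 0 = 1 := by
  ext ξ
  simp [sobolevWeight]

theorem sobolevWeight_lt_top (s ξ : ℝ) : sobolevWeight s ξ < ⊤ := ENNReal.ofReal_lt_top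

theorem sobolevWeight_mono {r s : ℝ} (h : r ≤ s) : sobolevWeight r ≤ sobolevWeight s := fun ξ =>
  ENNReal.ofReal_le_ofReal
    (Real.rpow_le_rpow_of_exponent_le (le_add_of_nonneg_right (sq_nonneg ξ)) h)

/-- The `H^s` norm of a square-integrable function, infinite outside `H^s`: the `L²` norm of the
Fourier transform for the measure `(1 + ξ²)^s dξ`. -/
def sobolevNorm (s : ℝ) (w : RealL2) : ℝ≥0∞ :=
  eLpNorm (fourierL2 w) 2 (volume.withDensity (sobolevWeight s))

theorem eLpNorm_two_sq {α E : Type*} [MeasurableSpace α] {μ : Measure α} [NormedAddCommGroup E]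
    (F : α → E) : eLpNorm F 2 μ ^ 2 = ∫⁻ x, ‖F x‖ₑ ^ 2 ∂μ := by
  simpa using eLpNorm_nnreal_pow_eq_lintegral (f := F) (μ := μ) (two_ne_zero (α := ℝ≥0))

theorem eLpNorm_two_withDensity_sobolevWeight_sq (s : ℝ) {F : ℝ → ℂ}
    (hF : AEStronglyMeasurable F) :
    eLpNorm F 2 (volume.withDensity (sobolevWeight s)) ^ 2 =
      ∫⁻ ξ, sobolevWeight s ξ * ‖F ξ‖ₑ ^ 2 := by
  rw [eLpNorm_two_sq, lintegral_withDensity_eq_lintegral_mul₀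
    (measurable_sobolevWeight s).aemeasurable (hF.enorm.pow_const 2)]
  rfl

theorem sobolevNorm_sq (s : ℝ) (w : RealL2) :
    sobolevNorm s w ^ 2 = ∫⁻ ξ, sobolevWeight s ξ * ‖fourierL2 w ξ‖ₑ ^ 2 :=
  eLpNorm_two_withDensity_sobolevWeight_sq s (Lp.aestronglyMeasurable _)

theorem eLpNorm_one_add_sq_rpow_mul (s : ℝ) {F : ℝ → ℂ} (hF : AEStronglyMeasurable F) :
    eLpNorm (fun ξ => (((1 + ξ ^ 2) ^ (s / 2) : ℝ) : ℂ) * F ξ) 2 volume =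
      eLpNorm F 2 (volume.withDensity (sobolevWeight s)) := by
  rw [← (ENNReal.pow_right_strictMono two_ne_zero).injective.eq_iff, eLpNorm_two_sq,
    eLpNorm_two_withDensity_sobolevWeight_sq s hF]
  refine lintegral_congr fun ξ => ?_
  have h : 0 < 1 + ξ ^ 2 := by positivity
  rw [enorm_mul, mul_pow, sobolevWeight, ← ofReal_norm, Complex.norm_real, Real.norm_of_nonneg
    (by positivity), ← ENNReal.ofReal_pow (by positivity), ← Real.rpow_mul_natCast h.le,
    Nat.cast_ofNat, div_mul_cancel₀ _ two_ne_zero]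

theorem sobolevNorm_mono {r s : ℝ} (h : r ≤ s) (w : RealL2) :
    sobolevNorm r w ≤ sobolevNorm s w :=
  eLpNorm_mono_measure _ (withDensity_mono (ae_of_all _ (sobolevWeight_mono h)))

theorem sobolevNorm_zero (w : RealL2) : sobolevNorm 0 w = ‖w‖ₑ := by
  rw [← enorm_norm w, ← norm_fourierL2, enorm_norm, Lp.enorm_def, sobolevNorm, sobolevWeight_zero,
    withDensity_one]

theorem enorm_le_sobolevNorm {s : ℝ} (hs : 0 ≤ s) (w : RealL2) : ‖w‖ₑ ≤ sobolevNorm s w :=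
  (sobolevNorm_zero w).ge.trans (sobolevNorm_mono hs w)

theorem enorm_sq_eq_lintegral_fourierL2 (w : RealL2) :
    ‖w‖ₑ ^ 2 = ∫⁻ ξ, ‖fourierL2 w ξ‖ₑ ^ 2 := by
  simp [← sobolevNorm_zero, sobolevNorm_sq, sobolevWeight_zero]

theorem aestronglyMeasurable_fourierL2_withDensity (s : ℝ) (w : RealL2) :
    AEStronglyMeasurable (fourierL2 w) (volume.withDensity (sobolevWeight s)) :=
  (Lp.aestronglyMeasurable _).mono_ac (withDensity_absolutelyContinuous _ _)

theorem sobolevNorm_eq_of_ae_eq {s : ℝ} {w : RealL2} {F : ℝ → ℂ}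
    (h : fourierL2 w =ᵐ[volume] F) :
    sobolevNorm s w = eLpNorm F 2 (volume.withDensity (sobolevWeight s)) :=
  eLpNorm_congr_ae ((withDensity_absolutelyContinuous _ _).ae_eq h)

theorem sobolevNorm_add_le (s : ℝ) (v w : RealL2) :
    sobolevNorm s (v + w) ≤ sobolevNorm s v + sobolevNorm s w := by
  have h : fourierL2 (v + w) =ᵐ[volume] ⇑(fourierL2 v) + ⇑(fourierL2 w) := by
    rw [map_add]
    exact Lp.coeFn_add _ _
  rw [sobolevNorm_eq_of_ae_eq h]
  exact eLpNorm_add_le (aestronglyMeasurable_fourierL2_withDensity s v)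
    (aestronglyMeasurable_fourierL2_withDensity s w) one_le_two

theorem sobolevNorm_smul (s c : ℝ) (w : RealL2) :
    sobolevNorm s (c • w) = ‖c‖ₑ * sobolevNorm s w := by
  have h : fourierL2 (c • w) =ᵐ[volume] c • ⇑(fourierL2 w) := by
    rw [map_smul]
    exact Lp.coeFn_smul _ _
  rw [sobolevNorm_eq_of_ae_eq h, eLpNorm_const_smul, sobolevNorm]

theorem sobolevNorm_neg (s : ℝ) (w : RealL2) : sobolevNorm s (-w) = sobolevNorm s w := by
  simpa using sobolevNorm_smul s (-1) w

theorem sobolevNorm_sub_le (s : ℝ) (v w : RealL2) :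
    sobolevNorm s (v - w) ≤ sobolevNorm s v + sobolevNorm s w := by
  rw [sub_eq_add_neg, ← sobolevNorm_neg s w]
  exact sobolevNorm_add_le _ _ _

theorem fourier_besselPotential_realL2ToTempered_apply (s : ℝ) (w : RealL2) (θ : 𝓢(ℝ, ℂ)) :
    𝓕 (TemperedDistribution.besselPotential ℝ ℂ s (realL2ToTempered w)) θ =
      ∫ ξ, θ ξ * ((((1 + ξ ^ 2) ^ (s / 2) : ℝ) : ℂ) * fourierL2 w ξ) := by
  have hw : realL2ToTempered w = Lp.toTemperedDistribution (complexify w) := rfl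
  rw [TemperedDistribution.fourier_besselPotential_eq_smulLeftCLM_fourier_apply, hw,
    Lp.fourier_toTemperedDistribution_eq, ← fourierL2_apply,
    TemperedDistribution.smulLeftCLM_apply_apply, Lp.toTemperedDistribution_apply]
  refine integral_congr_ae (ae_of_all _ fun ξ => ?_)
  have hg : (fun x : ℝ => (((1 + ‖x‖ ^ 2) ^ (s / 2) : ℝ) : ℂ)).HasTemperateGrowth := by fun_prop
  simp only [SchwartzMap.smulLeftCLM_apply_apply hg]
  simp only [Real.norm_eq_abs, sq_abs, smul_eq_mul]
  ring

theorem besselPotential_realL2ToTempered_eq_iff (s : ℝ) (w : RealL2) (g : ComplexL2) :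
    TemperedDistribution.besselPotential ℝ ℂ s (realL2ToTempered w) =
      Lp.toTemperedDistributionCLM ℂ (volume : Measure ℝ) 2 g ↔
    (𝓕 g : ComplexL2) =ᵐ[volume]
      fun ξ => (((1 + ξ ^ 2) ^ (s / 2) : ℝ) : ℂ) * fourierL2 w ξ := by
  have hinj : Function.Injective (𝓕 : 𝓢'(ℝ, ℂ) → 𝓢'(ℝ, ℂ)) :=
    Function.LeftInverse.injective (g := 𝓕⁻) fun T => fourierInv_fourier_eq T
  rw [← hinj.eq_iff, Lp.toTemperedDistributionCLM_apply, Lp.fourier_toTemperedDistribution_eq]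
  constructor
  · intro h
    refine (ae_eq_of_integral_test_mul_eq ((locallyIntegrable_coeFn_L2 _).continuous_smul (𝕜 := ℂ)
      (Complex.continuous_ofReal.comp (continuous_one_add_sq_rpow _)))
      (locallyIntegrable_coeFn_L2 _) fun θ hθ hθ' => ?_).symm
    have h := DFunLike.congr_fun h (hθ'.toSchwartzMap hθ)
    rwa [fourier_besselPotential_realL2ToTempered_apply, Lp.toTemperedDistribution_apply] at h
  · intro h
    ext θ
    rw [fourier_besselPotential_realL2ToTempered_apply, Lp.toTemperedDistribution_apply]
    refine integral_congr_ae ?_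
    filter_upwards [h] with ξ hξ
    rw [hξ, smul_eq_mul]

namespace SobolevH

variable {s : ℝ}

theorem enorm_eq_sobolevNorm (u : SobolevH s) : ‖u‖ₑ = sobolevNorm s (toL2 u) := by
  have hu : ‖u‖ = ‖u.bessel‖ := rfl
  rw [← enorm_norm u, hu, ← Lp.norm_fourier_eq, enorm_norm, Lp.enorm_def, sobolevNorm,
    ← eLpNorm_one_add_sq_rpow_mul s (Lp.aestronglyMeasurable _)]
  exact eLpNorm_congr_ae ((besselPotential_realL2ToTempered_eq_iff s _ _).1 u.bessel_spec)

theorem sobolevNorm_lt_top (u : SobolevH s) : sobolevNorm s (toL2 u) < ⊤ := by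
  rw [← enorm_eq_sobolevNorm]
  exact enorm_lt_top

theorem toL2_injective : Function.Injective (toL2 : SobolevH s → RealL2) :=
  Subtype.val_injective

end SobolevH

theorem mem_sobolevSubmodule_of_sobolevNorm_lt_top {s : ℝ} {w : RealL2}
    (h : sobolevNorm s w < ⊤) : w ∈ sobolevSubmodule s := by
  have hm : MemLp (fun ξ => (((1 + ξ ^ 2) ^ (s / 2) : ℝ) : ℂ) * fourierL2 w ξ) 2 volume := by
    refine ⟨?_, by rwa [eLpNorm_one_add_sq_rpow_mul s (Lp.aestronglyMeasurable _)]⟩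
    exact (Complex.continuous_ofReal.comp
      (continuous_one_add_sq_rpow _)).aestronglyMeasurable.mul (Lp.aestronglyMeasurable _)
  refine ⟨𝓕⁻ hm.toLp, (besselPotential_realL2ToTempered_eq_iff s w _).2 ?_⟩
  rw [fourier_fourierInv_eq]
  exact hm.coeFn_toLp

namespace SobolevH

variable {s : ℝ}

/-- The element of `H^s` given by a square-integrable function of finite `H^s` norm. -/
def mk (w : RealL2) (h : sobolevNorm s w < ⊤) : SobolevH s :=
  ⟨w, mem_sobolevSubmodule_of_sobolevNorm_lt_top h⟩

theorem norm_toL2_le (hs : 0 ≤ s) (u : SobolevH s) : ‖toL2 u‖ ≤ ‖u‖ := by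
  rw [← enorm_le_iff_norm_le, enorm_eq_sobolevNorm]
  exact enorm_le_sobolevNorm hs _

/-- The inclusion of `H^s` in `L²` for `s ≥ 0`. -/
def toL2L (hs : 0 ≤ s) : SobolevH s →L[ℝ] RealL2 :=
  LinearMap.mkContinuous toL2 1 fun u => by simpa using norm_toL2_le hs u

theorem isometry_besselₗ : Isometry (besselₗ : SobolevH s →ₗ[ℝ] ComplexL2) :=
  AddMonoidHomClass.isometry_of_norm _ fun _ => rfl

theorem completeSpace (hs : 0 ≤ s) : CompleteSpace (SobolevH s) := by
  refine Metric.complete_of_cauchySeq_tendsto fun u hu => ?_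
  have hu1 : CauchySeq fun n => toL2L hs (u n) := hu.map (toL2L hs).uniformContinuous
  have hu2 : CauchySeq fun n => besselₗ (u n) := hu.map isometry_besselₗ.uniformContinuous
  obtain ⟨w, hw⟩ := cauchySeq_tendsto_of_complete hu1
  obtain ⟨g, hg⟩ := cauchySeq_tendsto_of_complete hu2
  have hL2 : Continuous (realL2ToTempered : RealL2 → 𝓢'(ℝ, ℂ)) :=
    (Lp.toTemperedDistributionCLM ℂ (volume : Measure ℝ) 2).continuous.comp complexify.continuous
  have hwg : TemperedDistribution.besselPotential ℝ ℂ s (realL2ToTempered w) =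
      Lp.toTemperedDistributionCLM ℂ (volume : Measure ℝ) 2 g :=
    tendsto_nhds_unique
      ((((TemperedDistribution.besselPotential ℝ ℂ s).continuous.comp hL2).tendsto w).comp hw)
      ((((Lp.toTemperedDistributionCLM ℂ volume 2).continuous.tendsto g).comp hg).congr
        fun n => (bessel_spec (u n)).symm)
  let v : SobolevH s := ⟨w, g, hwg⟩
  have hv : besselₗ v = g := tempered_injective ((bessel_spec v).symm.trans hwg)
  exact ⟨v, isometry_besselₗ.isEmbedding.isInducing.tendsto_nhds_iff.2 (hv ▸ hg)⟩

end SobolevH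

/-! ### Translations -/

theorem contDiff_fourierChar_mul (h : ℝ) : ContDiff ℝ ∞ fun ξ : ℝ => (𝐞 (h * ξ) : ℂ) := by
  have hofReal : ContDiff ℝ ∞ fun ξ : ℝ => (ξ : ℂ) := Complex.ofRealCLM.contDiff
  simp only [Real.fourierChar_apply]
  fun_prop

theorem fourier_fourierChar_mul (θ : ℝ → ℂ) (h x : ℝ) :
    𝓕 (fun ξ => 𝐞 (h * ξ) * θ ξ) x = 𝓕 θ (x - h) := by
  rw [Real.fourier_real_eq, Real.fourier_real_eq]
  refine integral_congr_ae (ae_of_all _ fun ξ => ?_)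
  simp only [Circle.smul_def, smul_eq_mul]
  rw [← mul_assoc, ← Circle.coe_mul, ← AddChar.map_add_eq_mul]
  ring_nf

theorem fourier_comp_add_right (θ : ℝ → ℂ) (h x : ℝ) :
    𝓕 (fun ξ => θ (ξ + h)) x = 𝐞 (h * x) * 𝓕 θ x := by
  rw [Real.fourier_real_eq, Real.fourier_real_eq, ← integral_const_mul,
    ← integral_sub_right_eq_self _ h]
  refine integral_congr_ae (ae_of_all _ fun ξ => ?_)
  simp only [Circle.smul_def, smul_eq_mul, sub_add_cancel]
  rw [← mul_assoc, ← Circle.coe_mul, ← AddChar.map_add_eq_mul]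
  ring_nf

/-- The translate `x ↦ w (x + h)`. -/
def translateL2 (h : ℝ) : RealL2 →ₗᵢ[ℝ] RealL2 :=
  Lp.compMeasurePreservingₗᵢ ℝ (fun x => x + h) (measurePreserving_add_right volume h)

theorem coeFn_translateL2 (h : ℝ) (w : RealL2) : translateL2 h w =ᵐ[volume] fun x => w (x + h) :=
  Lp.coeFn_compMeasurePreserving w (measurePreserving_add_right volume h)

theorem translateL2_add (a b : ℝ) (w : RealL2) :
    translateL2 (a + b) w = translateL2 a (translateL2 b w) := by
  apply Lp.ext
  have hab := (measurePreserving_add_right (volume : Measure ℝ) a).quasiMeasurePreserving.ae_eq_comp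
    (coeFn_translateL2 b w)
  filter_upwards [coeFn_translateL2 (a + b) w, coeFn_translateL2 a (translateL2 b w), hab]
    with x h1 h2 h3
  rw [h1, h2, ← add_assoc]
  exact h3.symm

theorem fourierL2_translateL2 (h : ℝ) (w : RealL2) :
    fourierL2 (translateL2 h w) =ᵐ[volume] fun ξ => 𝐞 (h * ξ) * fourierL2 w ξ := by
  have hchar := contDiff_fourierChar_mul h
  refine ae_eq_of_integral_test_mul_eq (locallyIntegrable_coeFn_L2 _)
    ((locallyIntegrable_coeFn_L2 _).continuous_smul (𝕜 := ℂ) hchar.continuous) fun θ hθ hθ' => ?_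
  calc ∫ ξ, θ ξ * fourierL2 (translateL2 h w) ξ
      = ∫ x, 𝓕 θ x * translateL2 h w x := integral_mul_fourierL2 _ (hθ'.toSchwartzMap hθ)
    _ = ∫ x, 𝓕 θ x * w (x + h) := integral_congr_ae <| by
        filter_upwards [coeFn_translateL2 h w] with x hx
        rw [hx]
    _ = ∫ x, 𝓕 (fun ξ => 𝐞 (h * ξ) * θ ξ) x * w x := by
        rw [← integral_sub_right_eq_self (fun x => 𝓕 θ x * (w (x + h) : ℂ)) h]
        simp only [fourier_fourierChar_mul, sub_add_cancel]
    _ = ∫ ξ, 𝐞 (h * ξ) * θ ξ * fourierL2 w ξ :=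
        (integral_mul_fourierL2 w (hθ'.mul_left.toSchwartzMap (hchar.mul hθ))).symm
    _ = ∫ ξ, θ ξ * (𝐞 (h * ξ) * fourierL2 w ξ) := by
        simp only [mul_left_comm, mul_assoc]

theorem fourierL2_translateL2_sub (h : ℝ) (w : RealL2) :
    fourierL2 (translateL2 h w - w) =ᵐ[volume] fun ξ => (𝐞 (h * ξ) - 1) * fourierL2 w ξ := by
  rw [map_sub]
  filter_upwards [fourierL2_translateL2 h w,
    Lp.coeFn_sub (fourierL2 (translateL2 h w)) (fourierL2 w)] with ξ h1 h2
  rw [h2, Pi.sub_apply, h1, sub_one_mul]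

theorem sobolevNorm_translateL2 (s h : ℝ) (w : RealL2) :
    sobolevNorm s (translateL2 h w) = sobolevNorm s w := by
  rw [sobolevNorm_eq_of_ae_eq (fourierL2_translateL2 h w)]
  refine eLpNorm_congr_norm_ae (ae_of_all _ fun ξ => ?_)
  rw [norm_mul, Circle.norm_coe, one_mul]

theorem sobolevNorm_translateL2_sub_sq (s h : ℝ) (w : RealL2) :
    sobolevNorm s (translateL2 h w - w) ^ 2 =
      ∫⁻ ξ, ‖(𝐞 (h * ξ) - 1 : ℂ)‖ₑ ^ 2 * (sobolevWeight s ξ * ‖fourierL2 w ξ‖ₑ ^ 2) := by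
  rw [sobolevNorm_sq]
  refine lintegral_congr_ae ?_
  filter_upwards [fourierL2_translateL2_sub h w] with ξ hξ
  rw [hξ, enorm_mul, mul_pow, mul_left_comm]

theorem enorm_fourierChar_sub_one_le (x : ℝ) : ‖(𝐞 x - 1 : ℂ)‖ₑ ≤ 2 := by
  rw [← ofReal_norm, ← ENNReal.ofReal_ofNat]
  refine ENNReal.ofReal_le_ofReal ((norm_sub_le _ _).trans ?_)
  rw [Circle.norm_coe, norm_one, one_add_one_eq_two]

theorem tendsto_pow_two_zero_iff {α : Type*} {l : Filter α} {F : α → ℝ≥0∞} :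
    Tendsto (fun a => F a ^ 2) l (𝓝 0) ↔ Tendsto F l (𝓝 0) := by
  refine ⟨fun h => ?_, fun h => by simpa using ENNReal.Tendsto.pow (n := 2) h⟩
  have hroot := (ENNReal.continuous_rpow_const (y := 1 / 2)).continuousAt.tendsto.comp h
  rw [ENNReal.zero_rpow_of_pos one_half_pos] at hroot
  refine hroot.congr fun a => ?_
  rw [Function.comp_apply, ← ENNReal.rpow_natCast, ← ENNReal.rpow_mul]
  norm_num

theorem tendsto_sobolevNorm_translateL2_sub {s : ℝ} {w : RealL2} (hw : sobolevNorm s w < ⊤) :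
    Tendsto (fun h => sobolevNorm s (translateL2 h w - w)) (𝓝 0) (𝓝 0) := by
  have hcont : Continuous fun p : ℝ × ℝ => ‖(𝐞 (p.1 * p.2) - 1 : ℂ)‖ₑ ^ 2 := by
    have := Real.continuous_fourierChar
    fun_prop
  rw [← tendsto_pow_two_zero_iff]
  simp_rw [sobolevNorm_translateL2_sub_sq]
  rw [← lintegral_zero (μ := (volume : Measure ℝ))]
  refine tendsto_lintegral_filter_of_dominated_convergence
    (fun ξ => 2 ^ 2 * (sobolevWeight s ξ * ‖fourierL2 w ξ‖ₑ ^ 2)) ?_ ?_ ?_ ?_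
  · exact Eventually.of_forall fun h =>
      (hcont.comp (Continuous.prodMk_right h)).measurable.mul (by fun_prop)
  · refine Eventually.of_forall fun h => ae_of_all _ fun ξ => ?_
    gcongr
    exact enorm_fourierChar_sub_one_le _
  · rw [lintegral_const_mul _ (by fun_prop), ← sobolevNorm_sq]
    exact ENNReal.mul_ne_top (by norm_num) (ENNReal.pow_ne_top hw.ne)
  · refine ae_of_all _ fun ξ => ?_
    have h0 : Tendsto (fun h : ℝ => ‖(𝐞 (h * ξ) - 1 : ℂ)‖ₑ ^ 2) (𝓝 0) (𝓝 0) := by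
      simpa [Function.comp_def] using (hcont.comp (Continuous.prodMk_left ξ)).tendsto 0
    have hfin := sobolevWeight_lt_top s ξ
    simpa using ENNReal.Tendsto.mul_const h0 (b := sobolevWeight s ξ * ‖fourierL2 w ξ‖ₑ ^ 2)
      (Or.inr (by finiteness))

namespace SobolevH

variable {s : ℝ}

/-- Translation on `H^s`. -/
def translateH (h : ℝ) : SobolevH s →ₗᵢ[ℝ] SobolevH s where
  toFun u := mk (translateL2 h (toL2 u)) (by
    rw [sobolevNorm_translateL2]
    exact u.sobolevNorm_lt_top)
  map_add' u v := toL2_injective (map_add (translateL2 h) (toL2 u) (toL2 v))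
  map_smul' c u := toL2_injective (map_smul (translateL2 h) c (toL2 u))
  norm_map' u := by
    rw [← enorm_eq_iff_norm_eq, enorm_eq_sobolevNorm, enorm_eq_sobolevNorm]
    exact sobolevNorm_translateL2 s h (toL2 u)

theorem toL2_translateH (h : ℝ) (u : SobolevH s) :
    toL2 (translateH h u) = translateL2 h (toL2 u) := rfl

theorem enorm_translateH_sub (a h : ℝ) (u : SobolevH s) :
    ‖translateH h u - translateH a u‖ₑ =
      sobolevNorm s (translateL2 (h - a) (toL2 u) - toL2 u) := by
  have hh : translateL2 h (toL2 u) = translateL2 a (translateL2 (h - a) (toL2 u)) := by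
    rw [← translateL2_add, add_sub_cancel]
  rw [enorm_eq_sobolevNorm, map_sub, toL2_translateH, toL2_translateH, hh, ← map_sub,
    sobolevNorm_translateL2]

theorem continuous_translateH (u : SobolevH s) : Continuous fun h => translateH h u := by
  rw [continuous_iff_continuousAt]
  intro a
  have ha : Tendsto (fun h => h - a) (𝓝 a) (𝓝 0) := by
    simpa using (continuous_sub_right a).tendsto a
  rw [ContinuousAt, tendsto_iff_edist_tendsto_0]
  simp only [edist_eq_enorm_sub, enorm_translateH_sub]
  exact (tendsto_sobolevNorm_translateL2_sub u.sobolevNorm_lt_top).comp ha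

end SobolevH

/-! ### The Sobolev embedding and products -/

theorem lintegral_mul_sq_le {α : Type*} [MeasurableSpace α] {μ : Measure α}
    {F G : α → ℝ≥0∞} (hF : AEMeasurable F μ) (hG : AEMeasurable G μ) :
    (∫⁻ x, F x * G x ∂μ) ^ 2 ≤ (∫⁻ x, F x ^ 2 ∂μ) * ∫⁻ x, G x ^ 2 ∂μ := by
  have h := ENNReal.lintegral_mul_le_Lp_mul_Lq μ Real.HolderConjugate.two_two hF hG
  refine (ENNReal.pow_le_pow_left h).trans_eq ?_
  simp only [ENNReal.rpow_ofNat, mul_pow, ← ENNReal.rpow_natCast, ← ENNReal.rpow_mul]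
  norm_num

theorem sobolevWeight_half_sq (s ξ : ℝ) : sobolevWeight (s / 2) ξ ^ 2 = sobolevWeight s ξ := by
  rw [sq, sobolevWeight_mul, add_halves]

theorem sobolevWeight_neg_half_mul (s ξ : ℝ) :
    sobolevWeight (-s / 2) ξ * sobolevWeight (s / 2) ξ = 1 := by
  rw [sobolevWeight_mul, neg_div, neg_add_cancel, sobolevWeight_zero, Pi.one_apply]

theorem lintegral_sobolevWeight_neg_lt_top {s : ℝ} (hs : 1 / 2 < s) :
    ∫⁻ ξ, sobolevWeight (-s) ξ < ⊤ := by
  have h := integrable_rpow_neg_one_add_norm_sq (E := ℝ) (μ := volume) (r := 2 * s)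
    (by simp only [Module.finrank_self, Nat.cast_one]; linarith)
  refine lt_of_eq_of_lt (lintegral_congr fun ξ => ?_) h.lintegral_lt_top
  rw [sobolevWeight, Real.norm_eq_abs, sq_abs, neg_div, mul_div_cancel_left₀ s two_ne_zero]

theorem lintegral_enorm_fourierL2_sq_le (s : ℝ) (w : RealL2) :
    (∫⁻ ξ, ‖fourierL2 w ξ‖ₑ) ^ 2 ≤ (∫⁻ ξ, sobolevWeight (-s) ξ) * sobolevNorm s w ^ 2 := by
  calc (∫⁻ ξ, ‖fourierL2 w ξ‖ₑ) ^ 2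
      = (∫⁻ ξ, sobolevWeight (-s / 2) ξ * (sobolevWeight (s / 2) ξ * ‖fourierL2 w ξ‖ₑ)) ^ 2 := by
        simp only [← mul_assoc, sobolevWeight_neg_half_mul, one_mul]
    _ ≤ _ := lintegral_mul_sq_le (by fun_prop) (by fun_prop)
    _ = _ := by simp only [mul_pow, sobolevWeight_half_sq, sobolevNorm_sq]

theorem integrable_fourierL2 {s : ℝ} (hs : 1 / 2 < s) {w : RealL2} (hw : sobolevNorm s w < ⊤) :
    Integrable (fourierL2 w) :=
  ⟨Lp.aestronglyMeasurable _, (ENNReal.pow_lt_top_iff.1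
    ((lintegral_enorm_fourierL2_sq_le s w).trans_lt (ENNReal.mul_lt_top
      (lintegral_sobolevWeight_neg_lt_top hs) (ENNReal.pow_lt_top hw)))).resolve_right two_ne_zero⟩

theorem integral_fourierInv_mul_eq {F G : ℝ → ℂ} (hF : Integrable F) (hG : Integrable G) :
    ∫ ξ, 𝓕⁻ F ξ * G ξ = ∫ x, F x * 𝓕⁻ G x := by
  have h := VectorFourier.integral_fourierIntegral_smul_eq_flip (L := -innerₗ ℝ)
    Real.continuous_fourierChar (by simpa using by fun_prop) hF hG
  simpa [Real.fourierInv_eq, VectorFourier.fourierIntegral, mul_comm] using h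

theorem ae_eq_fourierInv_fourierL2 {w : RealL2} (hw : Integrable (fourierL2 w)) :
    (fun x => (w x : ℂ)) =ᵐ[volume] 𝓕⁻ (fourierL2 w : ℝ → ℂ) := by
  have hcont : Continuous (𝓕⁻ (fourierL2 w : ℝ → ℂ)) :=
    VectorFourier.fourierIntegral_continuous Real.continuous_fourierChar (by fun_prop) hw
  refine ae_eq_of_integral_test_mul_eq
    (((Lp.memLp w).ofReal (K := ℂ)).locallyIntegrable (by norm_num)) hcont.locallyIntegrable
    fun θ hθ hθ' => ?_
  let Θ := hθ'.toSchwartzMap hθ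
  have hΘ : 𝓕 ((𝓕⁻ Θ : 𝓢(ℝ, ℂ)) : ℝ → ℂ) = θ := by
    rw [← SchwartzMap.fourier_coe, fourier_fourierInv_eq]
    rfl
  calc ∫ x, θ x * w x = ∫ ξ, (𝓕⁻ Θ : 𝓢(ℝ, ℂ)) ξ * fourierL2 w ξ := by
        rw [integral_mul_fourierL2, hΘ]
    _ = ∫ ξ, 𝓕⁻ θ ξ * fourierL2 w ξ := by
        rw [SchwartzMap.fourierInv_coe]
        rfl
    _ = ∫ x, θ x * 𝓕⁻ (fourierL2 w : ℝ → ℂ) x := integral_fourierInv_mul_eq Θ.integrable hw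

theorem enorm_fourierInv_le (F : ℝ → ℂ) (x : ℝ) : ‖𝓕⁻ F x‖ₑ ≤ ∫⁻ ξ, ‖F ξ‖ₑ := by
  rw [Real.fourierInv_eq]
  refine (enorm_integral_le_lintegral_enorm _).trans_eq (lintegral_congr fun ξ => ?_)
  rw [← ofReal_norm, Circle.norm_smul, ofReal_norm]

theorem exists_ae_enorm_le_mul_sobolevNorm {s : ℝ} (hs : 1 / 2 < s) :
    ∃ K : ℝ≥0, ∀ w : RealL2, ∀ᵐ x, ‖w x‖ₑ ≤ K * sobolevNorm s w := by
  lift ∫⁻ ξ, sobolevWeight (-s) ξ to ℝ≥0 using (lintegral_sobolevWeight_neg_lt_top hs).ne with I hI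
  refine ⟨I + 1, fun w => ?_⟩
  rcases eq_top_or_lt_top (sobolevNorm s w) with hw | hw
  · simp [hw]
  filter_upwards [ae_eq_fourierInv_fourierL2 (integrable_fourierL2 hs hw)] with x hx
  calc ‖w x‖ₑ = ‖(w x : ℂ)‖ₑ := by rw [← ofReal_norm, ← ofReal_norm, Complex.norm_real]
    _ ≤ ∫⁻ ξ, ‖fourierL2 w ξ‖ₑ := hx ▸ enorm_fourierInv_le _ _
    _ ≤ (I + 1 : ℝ≥0) * sobolevNorm s w := by
        rw [← ENNReal.pow_le_pow_left_iff two_ne_zero]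
        refine (lintegral_enorm_fourierL2_sq_le s w).trans ?_
        rw [← hI, mul_pow]
        gcongr
        norm_cast
        nlinarith [I.2]

theorem exists_rpow_le_mul_rpow_add {r s : ℝ} (hr : 0 ≤ r) (hrs : r < s) {η : ℝ≥0} (hη : 0 < η) :
    ∃ C : ℝ≥0, ∀ y : ℝ≥0, 0 < y → y ^ r ≤ η * y ^ s + C := by
  refine ⟨η⁻¹ ^ (r / (s - r)), fun y hy => ?_⟩
  have hsr : 0 < s - r := sub_pos.2 hrs
  rcases le_total η⁻¹ (y ^ (s - r)) with h | h
  · refine le_add_right ?_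
    calc y ^ r = 1 * y ^ r := (one_mul _).symm
      _ ≤ η * y ^ (s - r) * y ^ r := by
          gcongr
          rwa [← div_le_iff₀' hη, one_div]
      _ = η * y ^ s := by rw [mul_assoc, ← NNReal.rpow_add hy.ne', sub_add_cancel]
  · refine le_add_left ?_
    calc y ^ r = (y ^ (s - r)) ^ (r / (s - r)) := by
          rw [← NNReal.rpow_mul, mul_div_cancel₀ _ hsr.ne']
      _ ≤ η⁻¹ ^ (r / (s - r)) := NNReal.rpow_le_rpow h (div_nonneg hr hsr.le)

theorem exists_sobolevWeight_le {r s : ℝ} (hr : 0 ≤ r) (hrs : r < s) {η : ℝ≥0} (hη : 0 < η) :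
    ∃ C : ℝ≥0, ∀ ξ, sobolevWeight r ξ ≤ η * sobolevWeight s ξ + C := by
  obtain ⟨C, hC⟩ := exists_rpow_le_mul_rpow_add hr hrs hη
  refine ⟨C, fun ξ => ?_⟩
  have hy : (0 : ℝ) < 1 + ξ ^ 2 := by positivity
  have hweight : ∀ t, sobolevWeight t ξ = ((Real.toNNReal (1 + ξ ^ 2) ^ t : ℝ≥0) : ℝ≥0∞) :=
    fun t => by rw [sobolevWeight, ENNReal.ofReal, Real.toNNReal_rpow_of_nonneg hy.le]
  rw [hweight, hweight]
  exact_mod_cast hC _ (Real.toNNReal_pos.2 hy)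

theorem exists_sobolevNorm_le {r s : ℝ} (hr : 0 ≤ r) (hrs : r < s) {η : ℝ≥0} (hη : 0 < η) :
    ∃ C : ℝ≥0, ∀ w : RealL2, sobolevNorm r w ≤ η * sobolevNorm s w + C * ‖w‖ₑ := by
  obtain ⟨C, hC⟩ := exists_sobolevWeight_le hr hrs (pow_pos hη 2)
  refine ⟨C + 1, fun w => ?_⟩
  rw [← ENNReal.pow_le_pow_left_iff two_ne_zero]
  calc sobolevNorm r w ^ 2
      ≤ ∫⁻ ξ, ((η ^ 2 : ℝ≥0) * (sobolevWeight s ξ * ‖fourierL2 w ξ‖ₑ ^ 2) +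
          C * ‖fourierL2 w ξ‖ₑ ^ 2) := by
        rw [sobolevNorm_sq]
        refine lintegral_mono fun ξ => ?_
        rw [← mul_assoc, ← add_mul]
        gcongr
        exact hC ξ
    _ = (η * sobolevNorm s w) ^ 2 + C * ‖w‖ₑ ^ 2 := by
        rw [lintegral_add_left (by fun_prop), lintegral_const_mul _ (by fun_prop),
          lintegral_const_mul _ (by fun_prop), ← sobolevNorm_sq,
          ← enorm_sq_eq_lintegral_fourierL2, mul_pow, ENNReal.coe_pow]
    _ ≤ (η * sobolevNorm s w) ^ 2 + ((C + 1 : ℝ≥0) * ‖w‖ₑ) ^ 2 := by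
        rw [mul_pow _ ‖w‖ₑ]
        gcongr
        norm_cast
        nlinarith [C.2]
    _ ≤ (η * sobolevNorm s w + (C + 1 : ℝ≥0) * ‖w‖ₑ) ^ 2 := by
        rw [add_sq' (η * sobolevNorm s w)]
        exact le_self_add

theorem exists_ae_enorm_le {s : ℝ} (hs : 1 / 2 < s) {η : ℝ≥0} (hη : 0 < η) :
    ∃ C : ℝ≥0, ∀ w : RealL2, ∀ᵐ x, ‖w x‖ₑ ≤ η * sobolevNorm s w + C * ‖w‖ₑ := by
  obtain ⟨r, hr, hrs⟩ := exists_between hs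
  obtain ⟨K, hK⟩ := exists_ae_enorm_le_mul_sobolevNorm hr
  obtain ⟨C, hC⟩ := exists_sobolevNorm_le (by linarith : 0 ≤ r) hrs
    (div_pos hη (by positivity : 0 < K + 1))
  refine ⟨K * C, fun w => ?_⟩
  filter_upwards [hK w] with x hx
  refine (hx.trans (mul_le_mul_right (hC w) _)).trans ?_
  rw [mul_add, ← mul_assoc, ← mul_assoc]
  gcongr
  · norm_cast
    rw [← mul_div_assoc, div_le_iff₀ (by positivity), mul_comm]
    gcongr
    exact le_self_add
  · norm_cast

theorem lintegral_enorm_mul_le {𝕜 : Type*} [RCLike 𝕜] {F G : ℝ → 𝕜} (hF : AEStronglyMeasurable F)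
    (hG : AEStronglyMeasurable G) : ∫⁻ ξ, ‖F ξ * G ξ‖ₑ ≤ eLpNorm F 2 * eLpNorm G 2 := by
  rw [← ENNReal.pow_le_pow_left_iff two_ne_zero, mul_pow, eLpNorm_two_sq, eLpNorm_two_sq]
  simp only [enorm_mul]
  exact lintegral_mul_sq_le hF.enorm hG.enorm

section Convolution

variable {𝕜 : Type*} [RCLike 𝕜] {ν : Measure ℝ} [SFinite ν] {Θ G H : ℝ → 𝕜}

theorem integrable_mul_mul_comp_sub (hΘ : MemLp Θ 2) (hG : Integrable G ν) (hH : MemLp H 2) :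
    Integrable (fun p : ℝ × ℝ => Θ p.1 * (G p.2 * H (p.1 - p.2))) (volume.prod ν) := by
  have hmeas : AEStronglyMeasurable (fun p : ℝ × ℝ => Θ p.1 * (G p.2 * H (p.1 - p.2)))
      (volume.prod ν) :=
    (hΘ.1.comp_fst (ν := ν)).mul (hG.1.convolution_integrand' (mul 𝕜 𝕜)
      (hH.1.mono_ac (quasiMeasurePreserving_sub_of_right_invariant volume ν).absolutelyContinuous))
  have hbound : ∀ η, ∫⁻ ξ, ‖Θ ξ * (G η * H (ξ - η))‖ₑ ≤
      ‖G η‖ₑ * (eLpNorm Θ 2 * eLpNorm H 2) := fun η => by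
    have hshift : MeasurePreserving (fun ξ : ℝ => ξ - η) := measurePreserving_sub_right volume η
    simp_rw [mul_left_comm (Θ _), enorm_mul (G η)]
    rw [lintegral_const_mul' _ _ enorm_ne_top, ← eLpNorm_comp_measurePreserving hH.1 hshift]
    gcongr
    exact lintegral_enorm_mul_le hΘ.1 (hH.1.comp_measurePreserving hshift)
  refine ⟨hmeas, ?_⟩
  rw [HasFiniteIntegral, lintegral_prod_symm _ hmeas.enorm]
  refine (lintegral_mono hbound).trans_lt ?_
  rw [lintegral_mul_const'' _ hG.1.enorm]
  exact ENNReal.mul_lt_top hG.2 (ENNReal.mul_lt_top hΘ.2 hH.2)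

theorem integrable_mul_convolution (hΘ : MemLp Θ 2) (hG : Integrable G ν) (hH : MemLp H 2) :
    Integrable fun ξ => Θ ξ * (G ⋆[mul 𝕜 𝕜, ν] H) ξ := by
  simp only [convolution, ContinuousLinearMap.mul_apply', ← integral_const_mul]
  exact (integrable_mul_mul_comp_sub hΘ hG hH).integral_prod_left

theorem locallyIntegrable_convolution (hG : Integrable G ν) (hH : MemLp H 2) :
    LocallyIntegrable (G ⋆[mul 𝕜 𝕜, ν] H) := by
  rw [locallyIntegrable_iff]
  intro K hK
  rw [← integrable_indicator_iff hK.measurableSet]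
  have hΘ : MemLp (K.indicator fun _ => (1 : 𝕜)) 2 (volume : Measure ℝ) :=
    memLp_indicator_const 2 hK.measurableSet 1 (Or.inr hK.measure_lt_top.ne)
  refine (integrable_mul_convolution hΘ hG hH).congr (ae_of_all _ fun ξ => ?_)
  by_cases hξ : ξ ∈ K <;> simp [hξ]

theorem integral_mul_convolution (hΘ : MemLp Θ 2) (hG : Integrable G ν) (hH : MemLp H 2) :
    ∫ ξ, Θ ξ * (G ⋆[mul 𝕜 𝕜, ν] H) ξ = ∫ η, G η * (∫ ξ, Θ ξ * H (ξ - η)) ∂ν := by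
  simp only [convolution, ContinuousLinearMap.mul_apply', ← integral_const_mul]
  rw [integral_integral_swap (integrable_mul_mul_comp_sub hΘ hG hH)]
  simp only [mul_left_comm]

theorem integrable_mul_integral_comp_add (hΘ : MemLp Θ 2) (hG : Integrable G ν)
    (hH : MemLp H 2) : Integrable fun ξ => H ξ * ∫ η, G η * Θ (ξ + η) ∂ν := by
  have hneg := Measure.measurePreserving_neg (volume : Measure ℝ)
  simpa [convolution, sub_eq_add_neg, add_comm] using (integrable_mul_convolution
    (hH.comp_measurePreserving hneg) hG (hΘ.comp_measurePreserving hneg)).comp_neg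

theorem integral_mul_integral_comp_add (hΘ : MemLp Θ 2) (hG : Integrable G ν) (hH : MemLp H 2) :
    ∫ ξ, H ξ * ∫ η, G η * Θ (ξ + η) ∂ν = ∫ ξ, Θ ξ * (G ⋆[mul 𝕜 𝕜, ν] H) ξ := by
  have hneg := Measure.measurePreserving_neg (volume : Measure ℝ)
  calc ∫ ξ, H ξ * ∫ η, G η * Θ (ξ + η) ∂ν
      = ∫ ξ, (H ∘ Neg.neg) ξ * (G ⋆[mul 𝕜 𝕜, ν] (Θ ∘ Neg.neg)) ξ := by
        rw [← integral_neg_eq_self]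
        simp [convolution, sub_eq_add_neg, add_comm]
    _ = ∫ η, G η * (∫ ξ, H (-ξ) * Θ (-(ξ - η))) ∂ν :=
        integral_mul_convolution (hH.comp_measurePreserving hneg) hG
          (hΘ.comp_measurePreserving hneg)
    _ = ∫ η, G η * (∫ ξ, Θ ξ * H (ξ - η)) ∂ν := by
        refine integral_congr_ae (ae_of_all _ fun η => congrArg (G η * ·) ?_)
        rw [← integral_sub_left_eq_self _ volume η]
        simp [mul_comm]
    _ = ∫ ξ, Θ ξ * (G ⋆[mul 𝕜 𝕜, ν] H) ξ := (integral_mul_convolution hΘ hG hH).symm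

end Convolution

theorem fourierInv_fourier_mul (θ : 𝓢(ℝ, ℂ)) (w : RealL2) (η : ℝ) :
    𝓕⁻ (fun x => 𝓕 (θ : ℝ → ℂ) x * w x) η = ∫ ξ, θ ξ * fourierL2 w (ξ - η) := by
  let θη : 𝓢(ℝ, ℂ) := SchwartzMap.compSubConstCLM ℂ (-η) θ
  have hθη : ∀ ξ, θη ξ = θ (ξ + η) := fun ξ => by simp [θη]
  calc 𝓕⁻ (fun x => 𝓕 (θ : ℝ → ℂ) x * w x) η
      = ∫ x, 𝓕 (fun ξ => θ (ξ + η)) x * w x := by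
        simp only [Real.fourierInv_eq, fourier_comp_add_right, Circle.smul_def, smul_eq_mul,
          mul_assoc, RCLike.inner_apply, conj_trivial]
    _ = ∫ ξ, θ (ξ + η) * fourierL2 w ξ := by
        simpa only [hθη, ← funext hθη] using (integral_mul_fourierL2 w θη).symm
    _ = ∫ ξ, θ ξ * fourierL2 w (ξ - η) := by
        rw [← integral_sub_right_eq_self _ η]
        simp only [sub_add_cancel]

theorem fourierL2_mul {g h p : RealL2} (hg : Integrable (fourierL2 g))
    (hp : p =ᵐ[volume] fun x => g x * h x) :
    fourierL2 p =ᵐ[volume] fourierL2 g ⋆[mul ℂ ℂ, volume] fourierL2 h := by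
  refine ae_eq_of_integral_test_mul_eq (locallyIntegrable_coeFn_L2 _)
    (locallyIntegrable_convolution hg (Lp.memLp _)) fun θ hθ hθ' => ?_
  let Θ := hθ'.toSchwartzMap hθ
  have hint : Integrable fun x => 𝓕 θ x * (h x : ℂ) :=
    ((𝓕 Θ).memLp 2 volume).integrable_mul (Lp.memLp h).ofReal
  calc ∫ ξ, θ ξ * fourierL2 p ξ = ∫ x, 𝓕 θ x * p x := integral_mul_fourierL2 p Θ
    _ = ∫ x, 𝓕 θ x * h x * 𝓕⁻ (fourierL2 g : ℝ → ℂ) x := integral_congr_ae <| by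
        filter_upwards [hp, ae_eq_fourierInv_fourierL2 hg] with x hx hgx
        rw [hx, ← hgx, Complex.ofReal_mul]
        ring
    _ = ∫ η, fourierL2 g η * ∫ ξ, θ ξ * fourierL2 h (ξ - η) := by
        rw [← integral_fourierInv_mul_eq hint hg]
        simp only [mul_comm (fourierL2 g _)]
        exact integral_congr_ae <|
          ae_of_all _ fun η => congrArg (· * _) (fourierInv_fourier_mul Θ h η)
    _ = ∫ ξ, θ ξ * (fourierL2 g ⋆[mul ℂ ℂ, volume] fourierL2 h) ξ :=
        (integral_mul_convolution (Θ.memLp 2 volume) hg (Lp.memLp _)).symm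

theorem sobolevWeight_le_of_sq_le {b ξ η : ℝ} (hb : 0 ≤ b) (h : ξ ^ 2 ≤ 4 * η ^ 2) :
    sobolevWeight b ξ ≤ ENNReal.ofReal (4 ^ b) * sobolevWeight b η := by
  rw [sobolevWeight, sobolevWeight, ← ENNReal.ofReal_mul (by positivity),
    ← Real.mul_rpow (by norm_num) (by positivity)]
  gcongr
  linarith

theorem sobolevWeight_anti_of_nonpos {r ξ η : ℝ} (hr : r ≤ 0) (h : ξ ^ 2 ≤ η ^ 2) :
    sobolevWeight r η ≤ sobolevWeight r ξ :=
  ENNReal.ofReal_le_ofReal (Real.rpow_le_rpow_of_nonpos (by positivity) (by linarith) hr)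

theorem sobolevWeight_mul_le {a b : ℝ} (hb : 0 ≤ b) (hba : b ≤ a) (ξ η : ℝ) :
    sobolevWeight b ξ * (sobolevWeight (-a) η * sobolevWeight (-b) (ξ - η)) ≤
      ENNReal.ofReal (4 ^ b) * (sobolevWeight (-a) η + sobolevWeight (-a) (ξ - η)) := by
  have hcancel : ∀ ζ, sobolevWeight b ζ * sobolevWeight (-b) ζ = 1 := fun ζ => by
    rw [sobolevWeight_mul, add_neg_cancel, sobolevWeight_zero, Pi.one_apply]
  rcases le_total (η ^ 2) ((ξ - η) ^ 2) with h | h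
  · calc sobolevWeight b ξ * (sobolevWeight (-a) η * sobolevWeight (-b) (ξ - η))
        ≤ ENNReal.ofReal (4 ^ b) * sobolevWeight b (ξ - η) *
            (sobolevWeight (-a) η * sobolevWeight (-b) (ξ - η)) := by
          gcongr
          exact sobolevWeight_le_of_sq_le hb (by nlinarith [sq_nonneg (ξ - 2 * η)])
      _ = ENNReal.ofReal (4 ^ b) * sobolevWeight (-a) η := by
          rw [mul_assoc, mul_left_comm (sobolevWeight b _), hcancel, mul_one]
      _ ≤ _ := by
          gcongr
          exact le_self_add
  · calc sobolevWeight b ξ * (sobolevWeight (-a) η * sobolevWeight (-b) (ξ - η))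
        ≤ ENNReal.ofReal (4 ^ b) * sobolevWeight b η *
            (sobolevWeight (-a) η * sobolevWeight (-b) (ξ - η)) := by
          gcongr
          exact sobolevWeight_le_of_sq_le hb (by nlinarith [sq_nonneg (ξ - 2 * η)])
      _ = ENNReal.ofReal (4 ^ b) * (sobolevWeight (b - a) η * sobolevWeight (-b) (ξ - η)) := by
          rw [sub_eq_add_neg b, ← sobolevWeight_mul]
          ring
      _ ≤ ENNReal.ofReal (4 ^ b) *
            (sobolevWeight (b - a) (ξ - η) * sobolevWeight (-b) (ξ - η)) := by
          gcongr
          exact sobolevWeight_anti_of_nonpos (by linarith) h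
      _ = ENNReal.ofReal (4 ^ b) * sobolevWeight (-a) (ξ - η) := by
          rw [sobolevWeight_mul]
          ring_nf
      _ ≤ _ := by
          gcongr
          exact le_add_self

theorem sobolevWeight_mul_lintegral_sq_le {a b : ℝ} (hb : 0 ≤ b) (hba : b ≤ a) {G H : ℝ → ℝ≥0∞}
    (hG : Measurable G) (hH : Measurable H) (ξ : ℝ) :
    sobolevWeight b ξ * (∫⁻ η, G η * H (ξ - η)) ^ 2 ≤
      ENNReal.ofReal (4 ^ b) * (2 * ∫⁻ η, sobolevWeight (-a) η) *
        ∫⁻ η, (sobolevWeight a η * G η ^ 2) * (sobolevWeight b (ξ - η) * H (ξ - η) ^ 2) := by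
  have hweights : sobolevWeight b ξ * ∫⁻ η, sobolevWeight (-a) η * sobolevWeight (-b) (ξ - η) ≤
      ENNReal.ofReal (4 ^ b) * (2 * ∫⁻ η, sobolevWeight (-a) η) := by
    rw [← lintegral_const_mul _ (by fun_prop)]
    refine (lintegral_mono fun η => sobolevWeight_mul_le hb hba ξ η).trans_eq ?_
    rw [lintegral_const_mul _ (by fun_prop), lintegral_add_left (by fun_prop),
      lintegral_sub_left_eq_self (sobolevWeight (-a)) ξ, two_mul]
  have hsplit : ∀ η, G η * H (ξ - η) =
      (sobolevWeight (-a / 2) η * sobolevWeight (-b / 2) (ξ - η)) *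
        ((sobolevWeight (a / 2) η * G η) * (sobolevWeight (b / 2) (ξ - η) * H (ξ - η))) :=
    fun η => by
      calc G η * H (ξ - η) = (sobolevWeight (-a / 2) η * sobolevWeight (a / 2) η) *
            (sobolevWeight (-b / 2) (ξ - η) * sobolevWeight (b / 2) (ξ - η)) *
            (G η * H (ξ - η)) := by
            rw [sobolevWeight_neg_half_mul, sobolevWeight_neg_half_mul, one_mul, one_mul]
        _ = _ := by ring
  have hCS : (∫⁻ η, G η * H (ξ - η)) ^ 2 ≤
      (∫⁻ η, sobolevWeight (-a) η * sobolevWeight (-b) (ξ - η)) *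
        ∫⁻ η, (sobolevWeight a η * G η ^ 2) * (sobolevWeight b (ξ - η) * H (ξ - η) ^ 2) := by
    simp only [hsplit]
    refine (lintegral_mul_sq_le (by fun_prop) (by fun_prop)).trans_eq ?_
    simp only [mul_pow, sobolevWeight_half_sq]
  calc _ ≤ _ := mul_le_mul_right hCS _
    _ ≤ _ := by
      rw [← mul_assoc]
      gcongr

theorem lintegral_lintegral_mul_comp_sub {F G : ℝ → ℝ≥0∞} (hF : Measurable F) (hG : Measurable G) :
    ∫⁻ ξ, ∫⁻ η, F η * G (ξ - η) = (∫⁻ η, F η) * ∫⁻ ξ, G ξ := by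
  rw [lintegral_lintegral_swap (by fun_prop), ← lintegral_mul_const _ hF]
  refine lintegral_congr fun η => ?_
  rw [lintegral_const_mul _ (by fun_prop), lintegral_sub_right_eq_self G η]

theorem exists_sobolevNorm_mul_le {a b : ℝ} (ha : 1 / 2 < a) (hb : 0 ≤ b) (hba : b ≤ a) :
    ∃ C : ℝ≥0, ∀ g h p : RealL2, sobolevNorm a g < ⊤ → (p =ᵐ[volume] fun x => g x * h x) →
      sobolevNorm b p ≤ C * (sobolevNorm a g * sobolevNorm b h) := by
  have hI := lintegral_sobolevWeight_neg_lt_top ha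
  lift ENNReal.ofReal (4 ^ b) * (2 * ∫⁻ ξ, sobolevWeight (-a) ξ) to ℝ≥0 using by finiteness
    with D hD
  refine ⟨D + 1, fun g h p hg hp => ?_⟩
  rw [← ENNReal.pow_le_pow_left_iff two_ne_zero]
  have hconv : ∀ᵐ ξ, ‖fourierL2 p ξ‖ₑ ≤ ∫⁻ η, ‖fourierL2 g η‖ₑ * ‖fourierL2 h (ξ - η)‖ₑ := by
    filter_upwards [fourierL2_mul (integrable_fourierL2 ha hg) hp] with ξ hξ
    simpa only [hξ, convolution, ContinuousLinearMap.mul_apply', enorm_mul] using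
      enorm_integral_le_lintegral_enorm fun η => mul ℂ ℂ (fourierL2 g η) (fourierL2 h (ξ - η))
  calc sobolevNorm b p ^ 2
      ≤ ∫⁻ ξ, D * ∫⁻ η, (sobolevWeight a η * ‖fourierL2 g η‖ₑ ^ 2) *
          (sobolevWeight b (ξ - η) * ‖fourierL2 h (ξ - η)‖ₑ ^ 2) := by
        rw [sobolevNorm_sq]
        refine lintegral_mono_ae ?_
        filter_upwards [hconv] with ξ hξ
        rw [hD]
        refine (mul_le_mul_right (ENNReal.pow_le_pow_left hξ) _).trans ?_
        exact sobolevWeight_mul_lintegral_sq_le hb hba (measurable_fourierL2 g).enorm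
          (measurable_fourierL2 h).enorm ξ
    _ = D * (sobolevNorm a g ^ 2 * sobolevNorm b h ^ 2) := by
        rw [lintegral_const_mul' _ _ ENNReal.coe_ne_top, sobolevNorm_sq, sobolevNorm_sq,
          lintegral_lintegral_mul_comp_sub
            (G := fun ζ => sobolevWeight b ζ * ‖fourierL2 h ζ‖ₑ ^ 2) (by fun_prop) (by fun_prop)]
    _ ≤ _ := by
        rw [mul_pow _ (_ * _), mul_pow (sobolevNorm a g)]
        gcongr
        norm_cast
        nlinarith [D.2]

/-! ### The Gagliardo seminorm -/

/-- The squared Gagliardo seminorm `∬ |w(x + h) - w(x)|² |h|^(-1-2σ) dx dh` of order `σ`. -/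
def gagliardo (σ : ℝ) (w : RealL2) : ℝ≥0∞ :=
  ∫⁻ h : ℝ, ENNReal.ofReal (|h| ^ (-1 - 2 * σ)) * ‖translateL2 h w - w‖ₑ ^ 2

/-- The ratio between the Gagliardo seminorm and the homogeneous Sobolev seminorm
`∫ |ξ|^(2σ) |ŵ(ξ)|² dξ`. -/
def gagliardoConst (σ : ℝ) : ℝ≥0∞ :=
  ∫⁻ h : ℝ, ENNReal.ofReal (|h| ^ (-1 - 2 * σ)) * ‖(𝐞 h - 1 : ℂ)‖ₑ ^ 2

theorem norm_fourierChar_sub_one (h : ℝ) : ‖(𝐞 h - 1 : ℂ)‖ = 2 * |Real.sin (Real.pi * h)| := by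
  rw [Real.fourierChar_apply, mul_comm _ Complex.I, Complex.norm_exp_I_mul_ofReal_sub_one,
    mul_assoc, mul_div_cancel_left₀ _ two_ne_zero, norm_mul, Real.norm_ofNat, Real.norm_eq_abs]

theorem measurable_enorm_fourierChar_sub_one : Measurable fun h : ℝ => ‖(𝐞 h - 1 : ℂ)‖ₑ := by
  have := Real.continuous_fourierChar
  fun_prop

theorem measurable_abs_rpow_mul_enorm_fourierChar_sub_one_sq (a : ℝ) :
    Measurable fun h : ℝ => ENNReal.ofReal (|h| ^ a) * ‖(𝐞 h - 1 : ℂ)‖ₑ ^ 2 :=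
  Measurable.mul (by fun_prop) (measurable_enorm_fourierChar_sub_one.pow_const 2)

theorem gagliardoConst_ne_zero (σ : ℝ) : gagliardoConst σ ≠ 0 := by
  refine ((lintegral_pos_iff_support
    (measurable_abs_rpow_mul_enorm_fourierChar_sub_one_sq _)).2 ?_).ne'
  refine (by simp : 0 < volume (Ioo (0 : ℝ) 1)).trans_le (measure_mono fun h hh => ?_)
  have hsin : 0 < Real.sin (Real.pi * h) := Real.sin_pos_of_pos_of_lt_pi
    (mul_pos Real.pi_pos hh.1) (mul_lt_of_lt_one_right Real.pi_pos hh.2)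
  have hpow : 0 < |h| ^ (-1 - 2 * σ) := Real.rpow_pos_of_pos (abs_pos.2 hh.1.ne') _
  have hchar : (𝐞 h - 1 : ℂ) ≠ 0 := by
    rw [← norm_ne_zero_iff, norm_fourierChar_sub_one]
    positivity
  simp [hpow, hchar]

theorem norm_fourierChar_sub_one_sq_le (h : ℝ) :
    ‖(𝐞 h - 1 : ℂ)‖ ^ 2 ≤ (2 * Real.pi) ^ 2 * min (|h| ^ 2) 1 := by
  have hpi := Real.pi_gt_three
  rw [norm_fourierChar_sub_one, mul_min_of_nonneg _ _ (by positivity), ← mul_pow, mul_one,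
    le_min_iff]
  constructor
  · gcongr ?_ ^ 2
    calc 2 * |Real.sin (Real.pi * h)| ≤ 2 * |Real.pi * h| :=
          mul_le_mul_of_nonneg_left Real.abs_sin_le_abs zero_le_two
      _ = 2 * Real.pi * |h| := by rw [abs_mul, abs_of_pos Real.pi_pos, mul_assoc]
  · gcongr ?_ ^ 2
    calc 2 * |Real.sin (Real.pi * h)| ≤ 2 * 1 :=
          mul_le_mul_of_nonneg_left (Real.abs_sin_le_one _) zero_le_two
      _ ≤ 2 * Real.pi := by linarith

theorem integrable_abs_rpow_mul_min {σ : ℝ} (h0 : 0 < σ) (h1 : σ < 1) :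
    Integrable fun h : ℝ => |h| ^ (-1 - 2 * σ) * min (|h| ^ 2) 1 := by
  refine (integrable_fun_norm_addHaar volume
    (f := fun t : ℝ => t ^ (-1 - 2 * σ) * min (t ^ 2) 1)).2 ?_
  simp only [Module.finrank_self, tsub_self, pow_zero, one_smul]
  rw [← Ioc_union_Ioi_eq_Ioi zero_le_one, integrableOn_union]
  constructor
  · have hnear : IntegrableOn (fun t : ℝ => t ^ (1 - 2 * σ)) (Ioc 0 1) :=
      (intervalIntegral.intervalIntegrable_rpow' (by linarith)).1
    refine hnear.congr_fun (fun t ht => ?_) measurableSet_Ioc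
    have hsq : t ^ 2 ≤ 1 := pow_le_one₀ ht.1.le ht.2
    simp only [min_eq_left hsq]
    rw [← Real.rpow_natCast, ← Real.rpow_add ht.1]
    norm_num
    ring_nf
  · have hfar : IntegrableOn (fun t : ℝ => t ^ (-1 - 2 * σ)) (Ioi 1) :=
      integrableOn_Ioi_rpow_of_lt (by linarith) zero_lt_one
    refine hfar.congr_fun (fun t (ht : 1 < t) => ?_) measurableSet_Ioi
    simp only [min_eq_right (one_le_pow₀ ht.le), mul_one]

theorem gagliardoConst_lt_top {σ : ℝ} (h0 : 0 < σ) (h1 : σ < 1) : gagliardoConst σ < ⊤ := by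
  have hint := (integrable_abs_rpow_mul_min h0 h1).const_mul ((2 * Real.pi) ^ 2)
  refine lt_of_le_of_lt (lintegral_mono fun h => ?_) hint.lintegral_lt_top
  rw [← ofReal_norm, ← ENNReal.ofReal_pow (norm_nonneg _), ← ENNReal.ofReal_mul (by positivity)]
  refine ENNReal.ofReal_le_ofReal ?_
  rw [mul_left_comm]
  gcongr
  exact norm_fourierChar_sub_one_sq_le h

theorem lintegral_eq_abs_mul_lintegral_comp_mul_right {F : ℝ → ℝ≥0∞} (hF : Measurable F) {ξ : ℝ}
    (hξ : ξ ≠ 0) : ∫⁻ h, F h = ENNReal.ofReal |ξ| * ∫⁻ h, F (h * ξ) := by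
  nth_rewrite 1 [← Real.smul_map_volume_mul_right hξ]
  rw [lintegral_smul_measure, lintegral_map hF (by fun_prop), smul_eq_mul]

theorem lintegral_abs_rpow_mul_fourierChar {σ : ℝ} (h0 : 0 < σ) (ξ : ℝ) :
    ∫⁻ h : ℝ, ENNReal.ofReal (|h| ^ (-1 - 2 * σ)) * ‖(𝐞 (h * ξ) - 1 : ℂ)‖ₑ ^ 2 =
      ENNReal.ofReal (|ξ| ^ (2 * σ)) * gagliardoConst σ := by
  rcases eq_or_ne ξ 0 with rfl | hξ
  · simp [Real.zero_rpow (by positivity : 2 * σ ≠ 0)]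
  have hpos := abs_pos.2 hξ
  have hscale := lintegral_eq_abs_mul_lintegral_comp_mul_right
    (measurable_abs_rpow_mul_enorm_fourierChar_sub_one_sq (-1 - 2 * σ)) hξ
  rw [gagliardoConst, hscale, ← mul_assoc, ← ENNReal.ofReal_mul (by positivity),
    ← lintegral_const_mul' _ _ ENNReal.ofReal_ne_top]
  refine lintegral_congr fun h => ?_
  rw [← mul_assoc, ← ENNReal.ofReal_mul (by positivity), abs_mul,
    Real.mul_rpow (abs_nonneg _) (abs_nonneg _), mul_left_comm, ← Real.rpow_add_one hpos.ne',
    ← Real.rpow_add hpos]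
  ring_nf
  simp [mul_comm]

theorem gagliardo_eq {σ : ℝ} (h0 : 0 < σ) (w : RealL2) :
    gagliardo σ w =
      gagliardoConst σ * ∫⁻ ξ, ENNReal.ofReal (|ξ| ^ (2 * σ)) * ‖fourierL2 w ξ‖ₑ ^ 2 := by
  have hchar : Measurable fun p : ℝ × ℝ => ‖(𝐞 (p.1 * p.2) - 1 : ℂ)‖ₑ :=
    measurable_enorm_fourierChar_sub_one.comp (by fun_prop : Measurable fun p : ℝ × ℝ => p.1 * p.2)
  calc gagliardo σ w
      = ∫⁻ h : ℝ, ∫⁻ ξ, ENNReal.ofReal (|h| ^ (-1 - 2 * σ)) *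
          (‖(𝐞 (h * ξ) - 1 : ℂ)‖ₑ ^ 2 * ‖fourierL2 w ξ‖ₑ ^ 2) := by
        refine lintegral_congr fun h => ?_
        rw [lintegral_const_mul' _ _ ENNReal.ofReal_ne_top, ← sobolevNorm_zero,
          sobolevNorm_translateL2_sub_sq]
        simp only [sobolevWeight_zero, Pi.one_apply, one_mul]
    _ = ∫⁻ ξ, ∫⁻ h : ℝ, ENNReal.ofReal (|h| ^ (-1 - 2 * σ)) *
          (‖(𝐞 (h * ξ) - 1 : ℂ)‖ₑ ^ 2 * ‖fourierL2 w ξ‖ₑ ^ 2) := by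
        exact lintegral_lintegral_swap (Measurable.aemeasurable
          (Measurable.mul (by fun_prop) (Measurable.mul (hchar.pow_const 2) (by fun_prop))))
    _ = ∫⁻ ξ, gagliardoConst σ * (ENNReal.ofReal (|ξ| ^ (2 * σ)) * ‖fourierL2 w ξ‖ₑ ^ 2) := by
        refine lintegral_congr fun ξ => ?_
        simp only [← mul_assoc]
        rw [lintegral_mul_const' _ _ (by finiteness), lintegral_abs_rpow_mul_fourierChar h0,
          mul_comm (gagliardoConst σ)]
    _ = _ := lintegral_const_mul _ (by fun_prop)

theorem sobolevNorm_sq_le_enorm_add_gagliardo {σ : ℝ} (h0 : 0 < σ) (h1 : σ < 1) (w : RealL2) :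
    sobolevNorm σ w ^ 2 ≤ ‖w‖ₑ ^ 2 + (gagliardoConst σ)⁻¹ * gagliardo σ w := by
  rw [gagliardo_eq h0, ← mul_assoc, ENNReal.inv_mul_cancel (gagliardoConst_ne_zero σ)
    (gagliardoConst_lt_top h0 h1).ne, one_mul, sobolevNorm_sq, enorm_sq_eq_lintegral_fourierL2,
    ← lintegral_add_left (by fun_prop)]
  refine lintegral_mono fun ξ => ?_
  rw [← one_add_mul]
  gcongr
  rw [sobolevWeight, ← ENNReal.ofReal_one, ← ENNReal.ofReal_add (by positivity) (by positivity),
    Real.rpow_mul (abs_nonneg ξ), Real.rpow_two, sq_abs]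
  refine ENNReal.ofReal_le_ofReal ?_
  simpa using Real.rpow_add_le_add_rpow zero_le_one (sq_nonneg ξ) h0.le h1.le

theorem gagliardo_le {σ : ℝ} (h0 : 0 < σ) (w : RealL2) :
    gagliardo σ w ≤ gagliardoConst σ * sobolevNorm σ w ^ 2 := by
  rw [gagliardo_eq h0, sobolevNorm_sq]
  gcongr with ξ
  refine ENNReal.ofReal_le_ofReal ?_
  rw [Real.rpow_mul (abs_nonneg ξ), Real.rpow_two, sq_abs]
  gcongr
  linarith

/-! ### Superposition operators -/

theorem exists_abs_le_of_continuous {k : ℝ → ℝ} (hk : Continuous k) (M : ℝ) :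
    ∃ B : ℝ≥0, ∀ x, |x| ≤ M → |k x| ≤ B := by
  obtain ⟨B, hB⟩ := (isCompact_Icc (a := -M) (b := M)).exists_bound_of_continuousOn
    hk.continuousOn
  exact ⟨B.toNNReal, fun x hx => (hB x (abs_le.1 hx)).trans (Real.le_coe_toNNReal B)⟩

theorem exists_abs_sub_le_of_continuous {k : ℝ → ℝ} (hk : Continuous k) (M : ℝ) {ε : ℝ}
    (hε : 0 < ε) :
    ∃ C : ℝ≥0, ∀ x y, |x| ≤ M → |y| ≤ M → |k x - k y| ≤ ε + C * |x - y| := by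
  obtain ⟨B, hB⟩ := exists_abs_le_of_continuous hk M
  obtain ⟨δ, hδ, hclose⟩ := Metric.uniformContinuousOn_iff.1
    ((isCompact_Icc (a := -M) (b := M)).uniformContinuousOn_of_continuous hk.continuousOn) ε hε
  lift δ to ℝ≥0 using hδ.le
  refine ⟨2 * B / δ, fun x y hx hy => ?_⟩
  push_cast
  rcases lt_or_ge |x - y| δ with hnear | hfar
  · have hlt : |k x - k y| < ε := hclose x (abs_le.1 hx) y (abs_le.1 hy) hnear
    have hnonneg : 0 ≤ 2 * B / δ * |x - y| := by positivity
    linarith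
  · have hosc : |k x - k y| ≤ 2 * B :=
      (abs_sub _ _).trans (by linarith [hB x hx, hB y hy])
    have hlin : 2 * (B : ℝ) ≤ 2 * B / δ * |x - y| := by
      rw [div_mul_eq_mul_div, le_div_iff₀ hδ]
      gcongr
    linarith

theorem exists_abs_sub_le_mul {f : ℝ → ℝ} (hf : ContDiff ℝ 1 f) (M : ℝ) :
    ∃ L : ℝ≥0, ∀ p q, |p| ≤ M → |q| ≤ M → |f p - f q| ≤ L * |p - q| := by
  obtain ⟨L, hL⟩ := exists_abs_le_of_continuous hf.continuous_deriv_one M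
  refine ⟨L, fun p q hp hq => ?_⟩
  exact (convex_Icc (-M) M).norm_image_sub_le_of_norm_deriv_le
    (fun x _ => hf.differentiable_one.differentiableAt) (fun x hx => hL x (abs_le.2 hx))
    (abs_le.1 hq) (abs_le.1 hp)

theorem exists_taylor_one_le {f : ℝ → ℝ} (hf : ContDiff ℝ 1 f) (M : ℝ) {ε : ℝ} (hε : 0 < ε) :
    ∃ C : ℝ≥0, ∀ p q, |p| ≤ M → |q| ≤ M →
      |f p - f q - deriv f q * (p - q)| ≤ (ε + C * |p - q|) * |p - q| := by
  obtain ⟨C, hC⟩ := exists_abs_sub_le_of_continuous hf.continuous_deriv_one M hε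
  refine ⟨C, fun p q hp hq => ?_⟩
  have hderiv : ∀ x, HasDerivAt (fun x => f x - deriv f q * x) (deriv f x - deriv f q) x :=
    fun x => hf.differentiable_one.differentiableAt.hasDerivAt.sub
      (by simpa using (hasDerivAt_id x).const_mul (deriv f q))
  have hmean := (convex_uIcc q p).norm_image_sub_le_of_norm_hasDerivWithin_le
    (C := ε + C * |p - q|) (fun x _ => (hderiv x).hasDerivWithinAt) (fun x hx => ?_)
    left_mem_uIcc right_mem_uIcc
  · rw [Real.norm_eq_abs, Real.norm_eq_abs] at hmean
    convert hmean using 2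
    ring
  · have hx' : |x| ≤ M := abs_le.2 (uIcc_subset_Icc (abs_le.1 hq) (abs_le.1 hp) hx)
    refine (hC x q hx' hq).trans ?_
    gcongr ε + C * ?_
    exact abs_sub_left_of_mem_uIcc hx

/- Write `f p - f p' = (f p - f (p' + c)) + (f (p' + c) - f p')` with `c = q - q'`: the first part
is a Lipschitz estimate, and the rest is the increment of `y ↦ f (y + c) - f y` from `q'` to `p'`.
-/
theorem exists_second_difference_le {f : ℝ → ℝ} (hf : ContDiff ℝ 1 f) (M : ℝ) :
    ∃ L : ℝ≥0, ∀ ε > 0, ∃ C : ℝ≥0, ∀ p q p' q', |p| ≤ M → |q| ≤ M → |p'| ≤ M → |q'| ≤ M →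
      |(f p - f q) - (f p' - f q')| ≤
        L * |(p - q) - (p' - q')| + (ε + C * |q - q'|) * |p' - q'| := by
  obtain ⟨L, hL⟩ := exists_abs_sub_le_mul hf (3 * M)
  refine ⟨L, fun ε hε => ?_⟩
  obtain ⟨C, hC⟩ := exists_abs_sub_le_of_continuous hf.continuous_deriv_one (3 * M) hε
  refine ⟨C, fun p q p' q' hp hq hp' hq' => ?_⟩
  set c := q - q' with hc
  have hshift : ∀ {y}, |y| ≤ M → |y| ≤ 3 * M ∧ |y + c| ≤ 3 * M := by
    intro y hy
    rw [hc]
    constructor <;> rw [abs_le] at * <;> constructor <;> linarith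
  have hderiv : ∀ y, HasDerivAt (fun y => f (y + c) - f y) (deriv f (y + c) - deriv f y) y :=
    fun y => (hf.differentiable_one.differentiableAt.hasDerivAt.comp_add_const y c).sub
      hf.differentiable_one.differentiableAt.hasDerivAt
  have hmean : |(f (p' + c) - f p') - (f (q' + c) - f q')| ≤ (ε + C * |c|) * |p' - q'| := by
    refine (convex_uIcc q' p').norm_image_sub_le_of_norm_hasDerivWithin_le
      (fun y _ => (hderiv y).hasDerivWithinAt) (fun y hy => ?_) left_mem_uIcc right_mem_uIcc
    have hy' : |y| ≤ M := abs_le.2 (uIcc_subset_Icc (abs_le.1 hq') (abs_le.1 hp') hy)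
    simpa using hC (y + c) y (hshift hy').2 (hshift hy').1
  have hlip := hL p (p' + c) (hshift hp).1 (hshift hp').2
  have hq_eq : q' + c = q := by rw [hc]; ring
  rw [hq_eq] at hmean
  calc |(f p - f q) - (f p' - f q')|
      = |(f p - f (p' + c)) + ((f (p' + c) - f p') - (f q - f q'))| := by ring_nf
    _ ≤ L * |p - (p' + c)| + (ε + C * |c|) * |p' - q'| :=
        (abs_add_le _ _).trans (add_le_add hlip hmean)
    _ = _ := by rw [hc, show p - (p' + (q - q')) = (p - q) - (p' - q') by ring]

theorem enorm_le_of_ae_abs_le {r u v : RealL2} {a b : ℝ≥0}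
    (h : ∀ᵐ x, |r x| ≤ a * |u x| + b * |v x|) : ‖r‖ₑ ≤ a * ‖u‖ₑ + b * ‖v‖ₑ := by
  have hle : ‖r‖ ≤ ‖(a : ℝ) • |u| + (b : ℝ) • |v|‖ := by
    apply Lp.norm_le_norm_of_ae_le
    filter_upwards [h, Lp.coeFn_add ((a : ℝ) • |u|) ((b : ℝ) • |v|), Lp.coeFn_smul (a : ℝ) |u|,
      Lp.coeFn_smul (b : ℝ) |v|, Lp.coeFn_abs u, Lp.coeFn_abs v] with x h hadd hau hbv hu hv
    rw [hadd, Pi.add_apply, hau, hbv, Pi.smul_apply, Pi.smul_apply, hu, hv]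
    exact h.trans (le_abs_self _)
  have htri : ‖r‖ ≤ a * ‖u‖ + b * ‖v‖ := by
    refine hle.trans ((norm_add_le _ _).trans_eq ?_)
    simp only [norm_smul, norm_abs_eq_norm, NNReal.norm_eq]
  simp only [enorm_eq_nnnorm]
  exact_mod_cast htri

/-- The superposition (Nemytskii) operator `w ↦ f ∘ w` on `L²`, with value `0` where `f ∘ w` is not
square integrable. -/
def superposition (f : ℝ → ℝ) (w : RealL2) : RealL2 :=
  open Classical in if h : MemLp (fun x => f (w x)) 2 volume then h.toLp else 0

theorem memLp_comp_of_ae_abs_le {f : ℝ → ℝ} (hf : ContDiff ℝ 1 f) (hf0 : f 0 = 0) {w : RealL2}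
    {M : ℝ} (hw : ∀ᵐ x, |w x| ≤ M) : MemLp (fun x => f (w x)) 2 volume := by
  obtain ⟨L, hL⟩ := exists_abs_sub_le_mul hf M
  refine (Lp.memLp w).of_le_mul (c := L) (hf.continuous.comp_aestronglyMeasurable
    (Lp.aestronglyMeasurable w)) ?_
  filter_upwards [hw] with x hx
  simpa [hf0] using hL (w x) 0 hx (by simpa using (abs_nonneg _).trans hx)

theorem coeFn_superposition {f : ℝ → ℝ} (hf : ContDiff ℝ 1 f) (hf0 : f 0 = 0) {w : RealL2} {M : ℝ}
    (hw : ∀ᵐ x, |w x| ≤ M) : superposition f w =ᵐ[volume] fun x => f (w x) := by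
  rw [superposition, dif_pos (memLp_comp_of_ae_abs_le hf hf0 hw)]
  exact MemLp.coeFn_toLp _

theorem superposition_zero {f : ℝ → ℝ} (hf : ContDiff ℝ 1 f) (hf0 : f 0 = 0) :
    superposition f 0 = 0 := by
  have hzero := Lp.coeFn_zero ℝ 2 (volume : Measure ℝ)
  have hbound : ∀ᵐ x, |(0 : RealL2) x| ≤ 0 := hzero.mono fun x hx => by rw [hx]; simp
  apply Lp.ext
  filter_upwards [coeFn_superposition hf hf0 hbound, hzero] with x hsup hx
  rw [hsup, hx, Pi.zero_apply, hf0]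

theorem exists_enorm_superposition_sub_le {f : ℝ → ℝ} (hf : ContDiff ℝ 1 f) (hf0 : f 0 = 0)
    (M : ℝ) : ∃ L : ℝ≥0, ∀ u v : RealL2, (∀ᵐ x, |u x| ≤ M) → (∀ᵐ x, |v x| ≤ M) →
      ‖superposition f u - superposition f v‖ₑ ≤ L * ‖u - v‖ₑ := by
  obtain ⟨L, hL⟩ := exists_abs_sub_le_mul hf M
  refine ⟨L, fun u v hu hv => ?_⟩
  suffices h : ∀ᵐ x, ‖(superposition f u - superposition f v) x‖₊ ≤ L * ‖(u - v) x‖₊ by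
    simp only [enorm_eq_nnnorm]
    exact_mod_cast Lp.nnnorm_le_mul_nnnorm_of_ae_le_mul h
  filter_upwards [hu, hv, coeFn_superposition hf hf0 hu, coeFn_superposition hf hf0 hv,
    Lp.coeFn_sub u v, Lp.coeFn_sub (superposition f u) (superposition f v)] with
    x hux hvx hfu hfv hsub hfsub
  rw [hfsub, hsub, Pi.sub_apply, Pi.sub_apply, hfu, hfv]
  exact hL _ _ hux hvx

/-! ### Derivatives in the mean -/

/-- `g` is the derivative of `w` in the mean: the difference quotients of `w` converge to `g` in
`L²`. -/
def HasL2Deriv (w g : RealL2) : Prop := HasDerivAt (fun h => translateL2 h w) g 0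

theorem translateL2_zero (w : RealL2) : translateL2 0 w = w := by
  apply Lp.ext
  filter_upwards [coeFn_translateL2 0 w] with x hx
  rw [hx, add_zero]

theorem hasL2Deriv_iff_tendsto {w g : RealL2} :
    HasL2Deriv w g ↔ Tendsto (fun h : ℝ => h⁻¹ • (translateL2 h w - w)) (𝓝[≠] 0) (𝓝 g) := by
  simp only [HasL2Deriv, hasDerivAt_iff_tendsto_slope_zero, zero_add, translateL2_zero]

theorem HasL2Deriv.sub {w₁ w₂ g₁ g₂ : RealL2} (h₁ : HasL2Deriv w₁ g₁) (h₂ : HasL2Deriv w₂ g₂) :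
    HasL2Deriv (w₁ - w₂) (g₁ - g₂) := by
  simpa only [HasL2Deriv, map_sub] using HasDerivAt.fun_sub h₁ h₂

theorem fourierL2_slope_translateL2 (w : RealL2) (h : ℝ) :
    fourierL2 (h⁻¹ • (translateL2 h w - w)) =ᵐ[volume]
      fun ξ => (h⁻¹ • (𝐞 (h * ξ) - 1 : ℂ)) * fourierL2 w ξ := by
  rw [map_smul]
  filter_upwards [Lp.coeFn_smul h⁻¹ (fourierL2 (translateL2 h w - w)),
    fourierL2_translateL2_sub h w] with ξ hsmul hsub
  rw [hsmul, Pi.smul_apply, hsub, smul_mul_assoc]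

theorem tendsto_slope_fourierChar (ξ : ℝ) :
    Tendsto (fun h : ℝ => h⁻¹ • (𝐞 (h * ξ) - 1 : ℂ)) (𝓝[≠] 0)
      (𝓝 (2 * Real.pi * Complex.I * ξ)) := by
  have hchar : HasDerivAt (fun h : ℝ => (𝐞 (h * ξ) : ℂ)) (ξ • (2 * Real.pi * Complex.I)) 0 := by
    simpa [Function.comp_def] using
      (Real.hasDerivAt_fourierChar (0 * ξ)).scomp 0 ((hasDerivAt_id 0).mul_const ξ)
  have hslope := hasDerivAt_iff_tendsto_slope_zero.1 hchar
  simpa [mul_comm (ξ : ℂ)] using hslope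

theorem HasL2Deriv.fourierL2_ae_eq {w g : RealL2} (h : HasL2Deriv w g) :
    fourierL2 g =ᵐ[volume] fun ξ => (2 * Real.pi * Complex.I * ξ) * fourierL2 w ξ := by
  obtain ⟨t, ht⟩ := exists_seq_tendsto (𝓝[≠] (0 : ℝ))
  have hlim : Tendsto (fun n => fourierL2 ((t n)⁻¹ • (translateL2 (t n) w - w))) atTop
      (𝓝 (fourierL2 g)) :=
    (fourierL2.continuous.tendsto g).comp ((hasL2Deriv_iff_tendsto.1 h).comp ht)
  obtain ⟨ns, hns, hae⟩ := (tendstoInMeasure_of_tendsto_Lp hlim).exists_seq_tendsto_ae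
  filter_upwards [hae, ae_all_iff.2 fun n => fourierL2_slope_translateL2 w (t n)] with ξ hξ hslope
  refine tendsto_nhds_unique hξ ?_
  simp_rw [hslope]
  exact (((tendsto_slope_fourierChar ξ).comp ht).comp hns.tendsto_atTop).mul_const _

theorem enorm_two_pi_I_mul_sq (ξ : ℝ) :
    ‖(2 * Real.pi * Complex.I * ξ : ℂ)‖ₑ ^ 2 = ENNReal.ofReal ((2 * Real.pi) ^ 2 * ξ ^ 2) := by
  rw [← ofReal_norm, ← ENNReal.ofReal_pow (norm_nonneg _)]
  simp [mul_pow]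

theorem enorm_slope_fourierChar_sub_le (h ξ : ℝ) :
    ‖h⁻¹ • (𝐞 (h * ξ) - 1 : ℂ) - 2 * Real.pi * Complex.I * ξ‖ₑ ≤
      2 * ‖(2 * Real.pi * Complex.I * ξ : ℂ)‖ₑ := by
  have hslope : ‖h⁻¹ • (𝐞 (h * ξ) - 1 : ℂ)‖ ≤ ‖(2 * Real.pi * Complex.I * ξ : ℂ)‖ := by
    rcases eq_or_ne h 0 with rfl | hh
    · simp
    · rw [norm_smul, norm_inv, inv_mul_le_iff₀ (norm_pos_iff.2 hh), norm_fourierChar_sub_one]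
      have hsin := Real.abs_sin_le_abs (x := Real.pi * (h * ξ))
      simp only [abs_mul, abs_of_pos Real.pi_pos] at hsin
      simp only [norm_mul, Complex.norm_ofNat, Complex.norm_real, Complex.norm_I, mul_one,
        Real.norm_eq_abs, abs_of_pos Real.pi_pos]
      linarith
  rw [← ofReal_norm, ← ofReal_norm, ← ENNReal.ofReal_ofNat, ← ENNReal.ofReal_mul zero_le_two]
  refine ENNReal.ofReal_le_ofReal ((norm_sub_le _ _).trans ?_)
  linarith

theorem sobolevWeight_mul_deriv_le (s ξ : ℝ) :
    sobolevWeight (s - 1) ξ * ENNReal.ofReal ((2 * Real.pi) ^ 2 * ξ ^ 2) ≤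
      7 ^ 2 * sobolevWeight s ξ := by
  have hsplit := sobolevWeight_mul (s - 1) 1 ξ
  rw [sub_add_cancel] at hsplit
  rw [← hsplit, mul_left_comm]
  gcongr
  simp only [sobolevWeight, Real.rpow_one]
  rw [← ENNReal.ofReal_ofNat, ← ENNReal.ofReal_pow (by norm_num),
    ← ENNReal.ofReal_mul (by norm_num)]
  apply ENNReal.ofReal_le_ofReal
  have hpi : (2 * Real.pi) ^ 2 ≤ 7 ^ 2 := by
    gcongr
    linarith [Real.pi_lt_d2]
  nlinarith [mul_le_mul_of_nonneg_right hpi (sq_nonneg ξ)]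

theorem sobolevWeight_le_add_deriv {s : ℝ} (hs : 0 ≤ s) (ξ : ℝ) :
    sobolevWeight s ξ ≤ ENNReal.ofReal (2 ^ s) +
      sobolevWeight (s - 1) ξ * ENNReal.ofReal ((2 * Real.pi) ^ 2 * ξ ^ 2) := by
  rcases le_total (ξ ^ 2) 1 with hlow | hhigh
  · refine le_add_right (ENNReal.ofReal_le_ofReal ?_)
    gcongr
    linarith
  · have hsplit := sobolevWeight_mul (s - 1) 1 ξ
    rw [sub_add_cancel] at hsplit
    rw [← hsplit]
    refine le_add_left (mul_le_mul_right (ENNReal.ofReal_le_ofReal ?_) _)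
    rw [Real.rpow_one]
    have hpi : 2 ≤ (2 * Real.pi) ^ 2 := by nlinarith [Real.pi_gt_three]
    nlinarith [mul_le_mul_of_nonneg_right hpi (sq_nonneg ξ)]

theorem HasL2Deriv.sobolevNorm_sq {w g : RealL2} (h : HasL2Deriv w g) (s : ℝ) :
    sobolevNorm s g ^ 2 = ∫⁻ ξ, sobolevWeight s ξ *
      ENNReal.ofReal ((2 * Real.pi) ^ 2 * ξ ^ 2) * ‖fourierL2 w ξ‖ₑ ^ 2 := by
  rw [_root_.sobolevNorm_sq]
  apply lintegral_congr_ae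
  filter_upwards [h.fourierL2_ae_eq] with ξ hξ
  rw [hξ, enorm_mul, mul_pow, ← mul_assoc, enorm_two_pi_I_mul_sq]

theorem HasL2Deriv.sobolevNorm_le {w g : RealL2} (h : HasL2Deriv w g) (s : ℝ) :
    sobolevNorm (s - 1) g ≤ 7 * sobolevNorm s w := by
  rw [← ENNReal.pow_le_pow_left_iff two_ne_zero, mul_pow, h.sobolevNorm_sq, _root_.sobolevNorm_sq,
    ← lintegral_const_mul _ (by fun_prop)]
  refine lintegral_mono fun ξ => ?_
  rw [← mul_assoc]
  gcongr ?_ * _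
  exact sobolevWeight_mul_deriv_le s ξ

theorem exists_sobolevNorm_le_deriv {s : ℝ} (hs : 0 ≤ s) : ∃ C : ℝ≥0, ∀ w g, HasL2Deriv w g →
    sobolevNorm s w ≤ C * ‖w‖ₑ + sobolevNorm (s - 1) g := by
  refine ⟨Real.toNNReal (2 ^ (s / 2)), fun w g h => ?_⟩
  have hconst : ENNReal.ofReal (2 ^ s) = ENNReal.ofReal (2 ^ (s / 2)) ^ 2 := by
    rw [← ENNReal.ofReal_pow (by positivity), ← Real.rpow_mul_natCast zero_le_two]
    norm_num
  rw [← ENNReal.pow_le_pow_left_iff two_ne_zero]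
  calc sobolevNorm s w ^ 2
      ≤ ∫⁻ ξ, (ENNReal.ofReal (2 ^ s) * ‖fourierL2 w ξ‖ₑ ^ 2 + sobolevWeight (s - 1) ξ *
          ENNReal.ofReal ((2 * Real.pi) ^ 2 * ξ ^ 2) * ‖fourierL2 w ξ‖ₑ ^ 2) := by
        rw [_root_.sobolevNorm_sq]
        refine lintegral_mono fun ξ => ?_
        rw [← add_mul]
        gcongr
        exact sobolevWeight_le_add_deriv hs ξ
    _ = (ENNReal.ofReal (2 ^ (s / 2)) * ‖w‖ₑ) ^ 2 + sobolevNorm (s - 1) g ^ 2 := by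
        rw [lintegral_add_left (by fun_prop), lintegral_const_mul _ (by fun_prop),
          ← enorm_sq_eq_lintegral_fourierL2, ← h.sobolevNorm_sq, hconst, mul_pow]
    _ ≤ (ENNReal.ofReal (2 ^ (s / 2)) * ‖w‖ₑ + sobolevNorm (s - 1) g) ^ 2 := by
        rw [add_sq]
        exact add_le_add_left le_self_add _

theorem lintegral_enorm_two_pi_I_mul_fourierL2_lt_top {w : RealL2} (hw : sobolevNorm 1 w < ⊤) :
    ∫⁻ ξ : ℝ, ‖(2 * Real.pi * Complex.I * ξ : ℂ) * fourierL2 w ξ‖ₑ ^ 2 < ⊤ := by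
  have hfin : 7 ^ 2 * sobolevNorm 1 w ^ 2 < ⊤ := by finiteness
  refine lt_of_le_of_lt ?_ hfin
  rw [sobolevNorm_sq, ← lintegral_const_mul _ (by fun_prop)]
  refine lintegral_mono fun ξ => ?_
  rw [enorm_mul, mul_pow, enorm_two_pi_I_mul_sq, ← mul_assoc]
  gcongr
  simpa [sobolevWeight_zero] using sobolevWeight_mul_deriv_le 1 ξ

theorem tendsto_lintegral_enorm_slope_fourierChar_sub {w : RealL2} (hw : sobolevNorm 1 w < ⊤) :
    Tendsto (fun h : ℝ => ∫⁻ ξ : ℝ, ‖(h⁻¹ • (𝐞 (h * ξ) - 1 : ℂ) - 2 * Real.pi * Complex.I * ξ) *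
      fourierL2 w ξ‖ₑ ^ 2) (𝓝[≠] 0) (𝓝 0) := by
  rw [← lintegral_zero (μ := (volume : Measure ℝ))]
  refine tendsto_lintegral_filter_of_dominated_convergence
    (fun ξ => 2 ^ 2 * ‖(2 * Real.pi * Complex.I * ξ : ℂ) * fourierL2 w ξ‖ₑ ^ 2) ?_ ?_ ?_ ?_
  · refine Eventually.of_forall fun h => ?_
    have := (contDiff_fourierChar_mul h).continuous
    fun_prop
  · refine Eventually.of_forall fun h => ae_of_all _ fun ξ => ?_
    rw [← mul_pow, enorm_mul, enorm_mul, ← mul_assoc]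
    gcongr
    exact enorm_slope_fourierChar_sub_le h ξ
  · rw [lintegral_const_mul _ (by fun_prop)]
    exact ENNReal.mul_ne_top (by norm_num) (lintegral_enorm_two_pi_I_mul_fourierL2_lt_top hw).ne
  · refine ae_of_all _ fun ξ => tendsto_pow_two_zero_iff.2 ?_
    simpa using (((tendsto_slope_fourierChar ξ).sub_const (2 * Real.pi * Complex.I * ξ)).mul_const
      (fourierL2 w ξ)).enorm

theorem exists_hasL2Deriv {w : RealL2} (hw : sobolevNorm 1 w < ⊤) : ∃ g, HasL2Deriv w g := by
  have hmem : MemLp (fun ξ : ℝ => (2 * Real.pi * Complex.I * ξ) * fourierL2 w ξ) 2 volume := by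
    refine ⟨(by fun_prop : Measurable _).aestronglyMeasurable, ?_⟩
    refine (ENNReal.pow_lt_top_iff.1 ?_).resolve_right two_ne_zero
    rw [eLpNorm_two_sq]
    exact lintegral_enorm_two_pi_I_mul_fourierL2_lt_top hw
  have hslope : Tendsto (fun h : ℝ => fourierL2 (h⁻¹ • (translateL2 h w - w))) (𝓝[≠] 0)
      (𝓝 hmem.toLp) := by
    rw [tendsto_iff_edist_tendsto_0, ← tendsto_pow_two_zero_iff]
    refine (tendsto_lintegral_enorm_slope_fourierChar_sub hw).congr fun h => ?_
    rw [Lp.edist_def, eLpNorm_two_sq]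
    apply lintegral_congr_ae
    filter_upwards [fourierL2_slope_translateL2 w h, hmem.coeFn_toLp] with ξ hquot hlim
    rw [Pi.sub_apply, hquot, hlim, sub_mul]
  have hisom : Isometry fourierL2 := AddMonoidHomClass.isometry_of_norm _ norm_fourierL2
  obtain ⟨g, hg⟩ := hisom.isClosedEmbedding.isClosed_range.mem_of_tendsto hslope
    (Eventually.of_forall fun h => mem_range_self _)
  rw [← hg] at hslope
  exact ⟨g, hasL2Deriv_iff_tendsto.2 (hisom.isEmbedding.tendsto_nhds_iff.2 hslope)⟩

theorem ae_comp_add {P : ℝ → Prop} (h : ∀ᵐ x, P x) (a : ℝ) : ∀ᵐ x : ℝ, P (x + a) :=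
  (measurePreserving_add_right (volume : Measure ℝ) a).quasiMeasurePreserving.ae h

theorem coeFn_translateL2_sub (h : ℝ) (w : RealL2) :
    translateL2 h w - w =ᵐ[volume] fun x => w (x + h) - w x := by
  filter_upwards [Lp.coeFn_sub (translateL2 h w) w, coeFn_translateL2 h w] with x hsub htrans
  rw [hsub, Pi.sub_apply, htrans]

theorem coeFn_translateL2_sub_sub_smul (h : ℝ) (w g : RealL2) :
    translateL2 h w - w - h • g =ᵐ[volume] fun x => w (x + h) - w x - h * g x := by
  filter_upwards [Lp.coeFn_sub (translateL2 h w - w) (h • g), coeFn_translateL2_sub h w,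
    Lp.coeFn_smul h g] with x hsub htrans hsmul
  rw [hsub, Pi.sub_apply, htrans, hsmul, Pi.smul_apply, smul_eq_mul]

theorem exists_ae_abs_le {s : ℝ} (hs : 1 / 2 < s) (M : ℝ≥0) :
    ∃ R : ℝ≥0, ∀ u : RealL2, sobolevNorm s u ≤ M → ∀ᵐ x, |u x| ≤ R := by
  obtain ⟨K, hK⟩ := exists_ae_enorm_le_mul_sobolevNorm hs
  refine ⟨K * M, fun u hu => (hK u).mono fun x hx => ?_⟩
  have hle : ‖u x‖ₑ ≤ K * M := hx.trans (by gcongr)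
  rw [enorm_eq_nnnorm] at hle
  exact_mod_cast hle

theorem eventually_ae_abs_translateL2_sub_le {w : RealL2} (hw : sobolevNorm 1 w < ⊤) {δ : ℝ≥0}
    (hδ : 0 < δ) : ∀ᶠ h in 𝓝 (0 : ℝ), ∀ᵐ x, |w (x + h) - w x| ≤ δ := by
  obtain ⟨K, hK⟩ := exists_ae_enorm_le_mul_sobolevNorm (s := 1) (by norm_num)
  have hlim : Tendsto (fun h => K * sobolevNorm 1 (translateL2 h w - w)) (𝓝 0) (𝓝 0) := by
    simpa using ENNReal.Tendsto.const_mul (tendsto_sobolevNorm_translateL2_sub hw)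
      (Or.inr ENNReal.coe_ne_top)
  filter_upwards [hlim.eventually (gt_mem_nhds (ENNReal.coe_pos.2 hδ))] with h hh
  filter_upwards [hK (translateL2 h w - w), coeFn_translateL2_sub h w] with x hx hsub
  rw [hsub, enorm_eq_nnnorm] at hx
  exact_mod_cast hx.trans hh.le

theorem HasL2Deriv.eventually_enorm_comp_le {f : ℝ → ℝ} (hf : ContDiff ℝ 1 f) {M : ℝ} {L : ℝ≥0}
    (hL : ∀ x, |x| ≤ M → |deriv f x| ≤ L) {w g p q : RealL2} (hw : sobolevNorm 1 w < ⊤)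
    (hM : ∀ᵐ x, |w x| ≤ M) (hp : p =ᵐ[volume] fun x => f (w x))
    (hq : q =ᵐ[volume] fun x => deriv f (w x) * g x) {ε : ℝ≥0} (hε : 0 < ε) :
    ∀ᶠ h in 𝓝 (0 : ℝ), ‖translateL2 h p - p - h • q‖ₑ ≤
      ε * ‖translateL2 h w - w‖ₑ + L * ‖translateL2 h w - w - h • g‖ₑ := by
  obtain ⟨C, hC⟩ := exists_taylor_one_le hf M (half_pos (NNReal.coe_pos.2 hε))
  have hδ : 0 < ε / 2 / (C + 1) := by positivity
  filter_upwards [eventually_ae_abs_translateL2_sub_le hw hδ] with h hh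
  apply enorm_le_of_ae_abs_le
  filter_upwards [hh, hM, ae_comp_add hM h, hp, ae_comp_add hp h, hq,
    coeFn_translateL2_sub_sub_smul h p q, coeFn_translateL2_sub_sub_smul h w g,
    coeFn_translateL2_sub h w] with x hsmall hx hxh hpx hpxh hqx hleft hright hsub
  rw [hleft, hright, hsub, hpx, hpxh, hqx]
  have hnear : ε / 2 + C * |w (x + h) - w x| ≤ ε := by
    have : (C : ℝ) * |w (x + h) - w x| ≤ (C + 1) * (ε / 2 / (C + 1) : ℝ≥0) := by
      gcongr
      linarith
    push_cast at this
    rw [mul_div_cancel₀ _ (by positivity)] at this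
    linarith
  calc |f (w (x + h)) - f (w x) - h * (deriv f (w x) * g x)|
      = |(f (w (x + h)) - f (w x) - deriv f (w x) * (w (x + h) - w x)) +
          deriv f (w x) * (w (x + h) - w x - h * g x)| := by ring_nf
    _ ≤ ε * |w (x + h) - w x| + L * |w (x + h) - w x - h * g x| := by
        refine (abs_add_le _ _).trans (add_le_add ((hC _ _ hxh hx).trans ?_) ?_)
        · gcongr
        · rw [abs_mul]
          gcongr
          exact hL _ hx

theorem HasL2Deriv.comp {f : ℝ → ℝ} (hf : ContDiff ℝ 1 f) {w g p q : RealL2}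
    (hw : sobolevNorm 1 w < ⊤) (hg : HasL2Deriv w g) (hp : p =ᵐ[volume] fun x => f (w x))
    (hq : q =ᵐ[volume] fun x => deriv f (w x) * g x) : HasL2Deriv p q := by
  obtain ⟨M, hM⟩ := exists_ae_abs_le (s := 1) (by norm_num) (sobolevNorm 1 w).toNNReal
  replace hM := hM w (ENNReal.coe_toNNReal hw.ne).ge
  obtain ⟨L, hL⟩ := exists_abs_le_of_continuous hf.continuous_deriv_one M
  obtain ⟨K, hK, hlip⟩ := hg.isBigO_sub.exists_pos
  have hlittle := hasDerivAt_iff_isLittleO.1 hg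
  simp only [translateL2_zero, sub_zero] at hlip hlittle
  rw [HasL2Deriv, hasDerivAt_iff_isLittleO, Asymptotics.isLittleO_iff]
  simp only [translateL2_zero, sub_zero]
  intro c hc
  lift c to ℝ≥0 using hc.le
  lift K to ℝ≥0 using hK.le
  replace hc : 0 < c := NNReal.coe_pos.1 hc
  replace hK : 0 < K := NNReal.coe_pos.1 hK
  filter_upwards [HasL2Deriv.eventually_enorm_comp_le hf hL hw hM hp hq
    (ε := c / 2 / K) (by positivity), hlip.bound, hlittle.bound (c := c / 2 / (L + 1))
    (by positivity)] with h hcomp hbig hsmall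
  have hfirst : (c / 2 / K : ℝ) * ‖translateL2 h w - w‖ ≤ c / 2 * ‖h‖ := by
    calc (c / 2 / K : ℝ) * ‖translateL2 h w - w‖ ≤ c / 2 / K * (K * ‖h‖) := by gcongr
      _ = c / 2 * ‖h‖ := by field_simp
  have hsecond : (L : ℝ) * ‖translateL2 h w - w - h • g‖ ≤ c / 2 * ‖h‖ := by
    calc (L : ℝ) * ‖translateL2 h w - w - h • g‖ ≤ (L + 1) * (c / 2 / (L + 1) * ‖h‖) := by
          gcongr
          linarith
      _ = c / 2 * ‖h‖ := by field_simp
  simp only [enorm_eq_nnnorm] at hcomp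
  have hcomp' : ‖translateL2 h p - p - h • q‖ ≤ (c / 2 / K : ℝ≥0) * ‖translateL2 h w - w‖ +
      L * ‖translateL2 h w - w - h • g‖ := by exact_mod_cast hcomp
  push_cast at hcomp'
  linarith

/-! ### Superposition operators on Sobolev spaces -/

theorem continuous_translateL2 (w : RealL2) : Continuous fun h => translateL2 h w := by
  have hw : sobolevNorm 0 w < ⊤ := by
    rw [sobolevNorm_zero]
    exact enorm_lt_top
  exact (SobolevH.toL2L le_rfl).continuous.comp (SobolevH.continuous_translateH (SobolevH.mk w hw))

theorem measurable_enorm_translateL2_sub (w : RealL2) :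
    Measurable fun h => ‖translateL2 h w - w‖ₑ :=
  ((continuous_translateL2 w).sub continuous_const).enorm.measurable

theorem add_sq_le_two_mul (x y : ℝ≥0∞) : (x + y) ^ 2 ≤ 2 * (x ^ 2 + y ^ 2) := by
  have h := ENNReal.rpow_add_le_mul_rpow_add_rpow x y (one_le_two (α := ℝ))
  norm_num at h
  exact h

theorem gagliardo_le_of_forall_translateL2 (σ : ℝ) {d u v : RealL2} {a b : ℝ≥0}
    (h : ∀ t, ‖translateL2 t d - d‖ₑ ≤ a * ‖translateL2 t u - u‖ₑ + b * ‖translateL2 t v - v‖ₑ) :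
    gagliardo σ d ≤ 2 * a ^ 2 * gagliardo σ u + 2 * b ^ 2 * gagliardo σ v := by
  have hu := measurable_enorm_translateL2_sub u
  have hv := measurable_enorm_translateL2_sub v
  unfold gagliardo
  rw [← lintegral_const_mul _ (by fun_prop), ← lintegral_const_mul _ (by fun_prop),
    ← lintegral_add_left (by fun_prop)]
  refine lintegral_mono fun t => ?_
  calc ENNReal.ofReal (|t| ^ (-1 - 2 * σ)) * ‖translateL2 t d - d‖ₑ ^ 2
      ≤ ENNReal.ofReal (|t| ^ (-1 - 2 * σ)) *
          (2 * ((a * ‖translateL2 t u - u‖ₑ) ^ 2 + (b * ‖translateL2 t v - v‖ₑ) ^ 2)) := by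
        gcongr
        exact (ENNReal.pow_le_pow_left (h t)).trans (add_sq_le_two_mul _ _)
    _ = _ := by ring

theorem sobolevNorm_le_of_forall_translateL2 {σ : ℝ} (h0 : 0 < σ) (h1 : σ < 1) {d u v : RealL2}
    {a b : ℝ≥0}
    (h : ∀ t, ‖translateL2 t d - d‖ₑ ≤ a * ‖translateL2 t u - u‖ₑ + b * ‖translateL2 t v - v‖ₑ) :
    sobolevNorm σ d ≤ ‖d‖ₑ + 2 * (a * sobolevNorm σ u + b * sobolevNorm σ v) := by
  set c := gagliardoConst σ
  have hc : c⁻¹ * c = 1 :=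
    ENNReal.inv_mul_cancel (gagliardoConst_ne_zero σ) (gagliardoConst_lt_top h0 h1).ne
  rw [← ENNReal.pow_le_pow_left_iff two_ne_zero]
  calc sobolevNorm σ d ^ 2
      ≤ ‖d‖ₑ ^ 2 + c⁻¹ * (2 * a ^ 2 * (c * sobolevNorm σ u ^ 2) +
          2 * b ^ 2 * (c * sobolevNorm σ v ^ 2)) := by
        refine (sobolevNorm_sq_le_enorm_add_gagliardo h0 h1 d).trans ?_
        gcongr
        refine (gagliardo_le_of_forall_translateL2 σ h).trans ?_
        gcongr <;> exact gagliardo_le h0 _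
    _ = ‖d‖ₑ ^ 2 + c⁻¹ * c * (2 * ((a * sobolevNorm σ u) ^ 2 + (b * sobolevNorm σ v) ^ 2)) := by
        ring
    _ ≤ ‖d‖ₑ ^ 2 + (2 * (a * sobolevNorm σ u + b * sobolevNorm σ v)) ^ 2 := by
        rw [hc, one_mul]
        gcongr
        refine le_of_le_of_eq (b := _ + (2 * (a * sobolevNorm σ u) ^ 2 +
          2 * (b * sobolevNorm σ v) ^ 2 + 8 * (a * sobolevNorm σ u) * (b * sobolevNorm σ v)))
          le_self_add ?_
        ring
    _ ≤ (‖d‖ₑ + 2 * (a * sobolevNorm σ u + b * sobolevNorm σ v)) ^ 2 := by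
        rw [add_sq]
        exact add_le_add_left le_self_add _

/-- The superposition operator of `f` is locally Lipschitz continuous on `H^s` up to an arbitrarily
small error and a multiple of the `L²` distance. The error is allowed for because the highest
derivative of `f` need not be locally Lipschitz continuous. -/
def SuperpositionBound (s : ℝ) (f : ℝ → ℝ) : Prop :=
  ∀ M : ℝ≥0, ∃ L : ℝ≥0, ∀ ε : ℝ≥0, 0 < ε → ∃ C : ℝ≥0, ∀ u v : RealL2,
    sobolevNorm s u ≤ M → sobolevNorm s v ≤ M →
      sobolevNorm s (superposition f u - superposition f v) ≤
        L * (sobolevNorm s (u - v) + ε) + C * ‖u - v‖ₑ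

theorem enorm_translateL2_superposition_sub_le {f : ℝ → ℝ} (hf : ContDiff ℝ 1 f) (hf0 : f 0 = 0)
    {R : ℝ} {L ε C m : ℝ≥0}
    (hsecond : ∀ p q p' q', |p| ≤ R → |q| ≤ R → |p'| ≤ R → |q'| ≤ R →
      |(f p - f q) - (f p' - f q')| ≤ L * |(p - q) - (p' - q')| + (ε + C * |q - q'|) * |p' - q'|)
    {u v : RealL2} (hu : ∀ᵐ x, |u x| ≤ R) (hv : ∀ᵐ x, |v x| ≤ R)
    (hm : ∀ᵐ x, ‖(u - v) x‖ₑ ≤ m) (t : ℝ) :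
    ‖translateL2 t (superposition f u - superposition f v) -
        (superposition f u - superposition f v)‖ₑ ≤
      L * ‖translateL2 t (u - v) - (u - v)‖ₑ + ↑(ε + C * m) * ‖translateL2 t v - v‖ₑ := by
  have hfu := coeFn_superposition hf hf0 hu
  have hfv := coeFn_superposition hf hf0 hv
  have hfsub := Lp.coeFn_sub (superposition f u) (superposition f v)
  have hsub := Lp.coeFn_sub u v
  apply enorm_le_of_ae_abs_le
  filter_upwards [coeFn_translateL2_sub t (superposition f u - superposition f v),
    coeFn_translateL2_sub t (u - v), coeFn_translateL2_sub t v, hfu, hfv, ae_comp_add hfu t,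
    ae_comp_add hfv t, hfsub, ae_comp_add hfsub t, hsub, ae_comp_add hsub t, hu, hv,
    ae_comp_add hu t, ae_comp_add hv t, hm] with
    x hd hw hv' hfux hfvx hfut hfvt hfx hft hx ht hux hvx hut hvt hmx
  rw [hx, Pi.sub_apply, enorm_eq_nnnorm, ENNReal.coe_le_coe, ← NNReal.coe_le_coe, coe_nnnorm,
    Real.norm_eq_abs] at hmx
  rw [hd, hw, hv', hfx, hft, hx, ht]
  simp only [Pi.sub_apply, hfux, hfvx, hfut, hfvt]
  rw [sub_sub_sub_comm (f _), sub_sub_sub_comm (u _)]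
  refine (hsecond _ _ _ _ hut hux hvt hvx).trans ?_
  push_cast
  gcongr

theorem superpositionBound_of_lt_one {s : ℝ} (hs : 1 / 2 < s) (hs1 : s < 1) {f : ℝ → ℝ}
    (hf : ContDiff ℝ 1 f) (hf0 : f 0 = 0) : SuperpositionBound s f := by
  intro M
  obtain ⟨R, hR⟩ := exists_ae_abs_le hs M
  obtain ⟨L, hL⟩ := exists_second_difference_le hf R
  obtain ⟨L₀, hL₀⟩ := exists_enorm_superposition_sub_le hf hf0 R
  refine ⟨2 * L + 2 * M, fun ε hε => ?_⟩
  obtain ⟨C, hC⟩ := hL ε hε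
  obtain ⟨B, hB⟩ := exists_ae_enorm_le hs (η := 1 / (C + 1)) (by positivity)
  refine ⟨L₀ + 2 * M * C * B, fun u v hu hv => ?_⟩
  have hfin : sobolevNorm s (u - v) ≠ ⊤ :=
    ((sobolevNorm_sub_le s u v).trans_lt
      (ENNReal.add_lt_top.2 ⟨hu.trans_lt ENNReal.coe_lt_top, hv.trans_lt ENNReal.coe_lt_top⟩)).ne
  lift sobolevNorm s (u - v) to ℝ≥0 using hfin with N hN
  have hm : ∀ᵐ x, ‖(u - v) x‖ₑ ≤ ↑(1 / (C + 1) * N + B * ‖u - v‖₊) := by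
    simpa [← hN, enorm_eq_nnnorm (u - v)] using hB (u - v)
  have hsup : (C * (1 / (C + 1) * N + B * ‖u - v‖₊) : ℝ≥0) ≤ N + C * B * ‖u - v‖₊ := by
    have hone : C * (1 / (C + 1)) ≤ 1 := by
      rw [mul_one_div]
      exact div_le_one_of_le₀ le_self_add (by positivity)
    calc C * (1 / (C + 1) * N + B * ‖u - v‖₊)
        = C * (1 / (C + 1)) * N + C * B * ‖u - v‖₊ := by ring
      _ ≤ 1 * N + C * B * ‖u - v‖₊ := by gcongr
      _ = _ := by rw [one_mul]
  calc sobolevNorm s (superposition f u - superposition f v)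
      ≤ L₀ * ‖u - v‖ₑ + 2 * (L * N + ↑(ε + C * (1 / (C + 1) * N + B * ‖u - v‖₊)) * M) := by
        refine (sobolevNorm_le_of_forall_translateL2 (by linarith) hs1
          (enorm_translateL2_superposition_sub_le hf hf0 hC (hR u hu) (hR v hv) hm)).trans ?_
        rw [← hN]
        gcongr
        exact hL₀ u v (hR u hu) (hR v hv)
    _ ≤ L₀ * ‖u - v‖ₑ + 2 * (L * N + ↑(ε + (N + C * B * ‖u - v‖₊)) * M) := by gcongr
    _ ≤ L₀ * ‖u - v‖ₑ + 2 * (L * N + ↑(ε + (N + C * B * ‖u - v‖₊)) * M) + 2 * L * ε :=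
        le_self_add
    _ = _ := by
        rw [enorm_eq_nnnorm (u - v)]
        push_cast
        ring

theorem exists_ae_eq_superposition_mul {g : ℝ → ℝ} (hg : ContDiff ℝ 1 g) (hg0 : g 0 = 0)
    {u : RealL2} {R : ℝ} (hu : ∀ᵐ x, |u x| ≤ R) (w : RealL2) :
    ∃ p : RealL2, p =ᵐ[volume] fun x => superposition g u x * w x := by
  obtain ⟨B, hB⟩ := exists_abs_le_of_continuous hg.continuous R
  have hmem : MemLp (fun x => superposition g u x * w x) 2 volume := by
    refine (Lp.memLp w).of_le_mul (c := B)
      ((Lp.aestronglyMeasurable _).mul (Lp.aestronglyMeasurable w)) ?_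
    filter_upwards [hu, coeFn_superposition hg hg0 hu] with x hx hgx
    rw [norm_mul, hgx]
    gcongr
    exact hB _ hx
  exact ⟨hmem.toLp, hmem.coeFn_toLp⟩

/-- The part of `f'` that vanishes at `0`, so that it acts on `L²` by superposition. -/
def centeredDeriv (f : ℝ → ℝ) (x : ℝ) : ℝ := deriv f x - deriv f 0

theorem centeredDeriv_zero (f : ℝ → ℝ) : centeredDeriv f 0 = 0 := sub_self _

theorem contDiff_centeredDeriv {f : ℝ → ℝ} {n : ℕ} (hf : ContDiff ℝ (n + 1) f) :
    ContDiff ℝ n (centeredDeriv f) :=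
  (contDiff_succ_iff_deriv.1 hf).2.2.sub contDiff_const

theorem HasL2Deriv.superposition {f : ℝ → ℝ} (hf : ContDiff ℝ 2 f) (hf0 : f 0 = 0)
    {u u' p : RealL2} {R : ℝ} (hu : ∀ᵐ x, |u x| ≤ R) (hu1 : sobolevNorm 1 u < ⊤)
    (hu' : HasL2Deriv u u')
    (hp : p =ᵐ[volume] fun x => superposition (centeredDeriv f) u x * u' x) :
    HasL2Deriv (superposition f u) (p + deriv f 0 • u') := by
  have hf1 : ContDiff ℝ 1 f := hf.of_le one_le_two
  refine hu'.comp hf1 hu1 (coeFn_superposition hf1 hf0 hu) ?_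
  filter_upwards [hp, Lp.coeFn_add p (deriv f 0 • u'), Lp.coeFn_smul (deriv f 0) u',
    coeFn_superposition (contDiff_centeredDeriv (n := 1) hf) (centeredDeriv_zero f) hu] with
    x hpx hadd hsmul hsup
  rw [hadd, Pi.add_apply, hpx, hsmul, Pi.smul_apply, hsup, centeredDeriv, smul_eq_mul]
  ring

/- With `g = f' - f'(0)`, the derivative of `f(u) - f(v)` is
`g(u) (u' - v') + (g(u) - g(v)) v' + f'(0) (u' - v')`. -/
theorem exists_hasL2Deriv_superposition_sub {f : ℝ → ℝ} (hf : ContDiff ℝ 2 f) (hf0 : f 0 = 0)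
    {u v u' v' : RealL2} {R : ℝ} (hu : ∀ᵐ x, |u x| ≤ R) (hv : ∀ᵐ x, |v x| ≤ R)
    (hu1 : sobolevNorm 1 u < ⊤) (hv1 : sobolevNorm 1 v < ⊤)
    (hu' : HasL2Deriv u u') (hv' : HasL2Deriv v v') :
    ∃ p q : RealL2,
      (p =ᵐ[volume] fun x => superposition (centeredDeriv f) u x * (u' - v') x) ∧
      (q =ᵐ[volume] fun x =>
        (superposition (centeredDeriv f) u - superposition (centeredDeriv f) v) x * v' x) ∧
      HasL2Deriv (superposition f u - superposition f v) (p + q + deriv f 0 • (u' - v')) := by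
  have hg : ContDiff ℝ 1 (centeredDeriv f) := contDiff_centeredDeriv (n := 1) hf
  have hg0 := centeredDeriv_zero f
  obtain ⟨pu, hpu⟩ := exists_ae_eq_superposition_mul hg hg0 hu u'
  obtain ⟨pv, hpv⟩ := exists_ae_eq_superposition_mul hg hg0 hv v'
  obtain ⟨p, hp⟩ := exists_ae_eq_superposition_mul hg hg0 hu (u' - v')
  refine ⟨p, pu - pv - p, hp, ?_, ?_⟩
  · filter_upwards [hpu, hpv, hp, Lp.coeFn_sub (pu - pv) p, Lp.coeFn_sub pu pv,
      Lp.coeFn_sub u' v',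
      Lp.coeFn_sub (superposition (centeredDeriv f) u) (superposition (centeredDeriv f) v)] with
      x hpux hpvx hpx hsub hsubp hsub' hsubg
    rw [hsub, Pi.sub_apply, hsubp, Pi.sub_apply, hpux, hpvx, hpx, hsub', hsubg, Pi.sub_apply,
      Pi.sub_apply]
    ring
  · have hsplit : p + (pu - pv - p) + deriv f 0 • (u' - v') =
        pu + deriv f 0 • u' - (pv + deriv f 0 • v') := by module
    rw [hsplit]
    exact (hu'.superposition hf hf0 hu hu1 hpu).sub (hv'.superposition hf hf0 hv hv1 hpv)

theorem exists_sobolevNorm_mul_l2Deriv_le {s a : ℝ} (hs : 1 ≤ s) (ha : 1 / 2 < a)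
    (hsa : s - 1 ≤ a) :
    ∃ P : ℝ≥0, ∀ h w w' p : RealL2, sobolevNorm a h < ⊤ → HasL2Deriv w w' →
      (p =ᵐ[volume] fun x => h x * w' x) →
      sobolevNorm (s - 1) p ≤ P * (sobolevNorm a h * sobolevNorm s w) := by
  obtain ⟨P, hP⟩ := exists_sobolevNorm_mul_le ha (b := s - 1) (by linarith) hsa
  refine ⟨P * 7, fun h w w' p hh hw' hp => (hP _ _ _ hh hp).trans
    ((mul_le_mul_right (mul_le_mul_right (hw'.sobolevNorm_le s) _) _).trans_eq ?_)⟩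
  push_cast
  ring

theorem exists_sobolevNorm_superposition_sub_le {s a : ℝ} (hs : 1 ≤ s) (ha : 1 / 2 < a)
    (hsa : s - 1 ≤ a) {f : ℝ → ℝ} (hf : ContDiff ℝ 2 f) (hf0 : f 0 = 0) (M : ℝ≥0) :
    ∃ C : ℝ≥0, ∀ u v, sobolevNorm s u ≤ M → sobolevNorm s v ≤ M →
      sobolevNorm a (superposition (centeredDeriv f) u) < ⊤ →
      sobolevNorm a (superposition (centeredDeriv f) v) < ⊤ →
      sobolevNorm s (superposition f u - superposition f v) ≤ C * (‖u - v‖ₑ +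
        sobolevNorm a (superposition (centeredDeriv f) u) * sobolevNorm s (u - v) +
        sobolevNorm a (superposition (centeredDeriv f) u - superposition (centeredDeriv f) v) *
          sobolevNorm s v + sobolevNorm s (u - v)) := by
  set g := centeredDeriv f
  obtain ⟨R, hR⟩ := exists_ae_abs_le (s := s) (by linarith) M
  obtain ⟨L, hL⟩ := exists_enorm_superposition_sub_le (hf.of_le one_le_two) hf0 R
  obtain ⟨P, hP⟩ := exists_sobolevNorm_mul_l2Deriv_le hs ha hsa
  obtain ⟨D, hD⟩ := exists_sobolevNorm_le_deriv (s := s) (by linarith)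
  set C := max (max (D * L) P) (‖deriv f 0‖₊ * 7)
  have hDL : D * L ≤ C := le_max_of_le_left (le_max_left _ _)
  have hPC : P ≤ C := le_max_of_le_left (le_max_right _ _)
  have hf7 : ‖deriv f 0‖₊ * 7 ≤ C := le_max_right _ _
  refine ⟨C, fun u v hu hv hgu hgv => ?_⟩
  have hone {w : RealL2} (hw : sobolevNorm s w ≤ M) : sobolevNorm 1 w < ⊤ :=
    ((sobolevNorm_mono hs _).trans hw).trans_lt ENNReal.coe_lt_top
  obtain ⟨u', hu'⟩ := exists_hasL2Deriv (hone hu)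
  obtain ⟨v', hv'⟩ := exists_hasL2Deriv (hone hv)
  obtain ⟨p, q, hp, hq, hpq⟩ :=
    exists_hasL2Deriv_superposition_sub hf hf0 (hR u hu) (hR v hv) (hone hu) (hone hv) hu' hv'
  have hp_le := hP _ _ _ _ hgu (hu'.sub hv') hp
  have hq_le := hP _ _ _ _ ((sobolevNorm_sub_le _ _ _).trans_lt (by finiteness)) hv' hq
  have hlin_le : sobolevNorm (s - 1) (deriv f 0 • (u' - v')) ≤
      (‖deriv f 0‖₊ * 7 : ℝ≥0) * sobolevNorm s (u - v) := by
    rw [sobolevNorm_smul, ENNReal.coe_mul, mul_assoc]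
    exact mul_le_mul_right ((hu'.sub hv').sobolevNorm_le s) _
  have hlow_le : D * ‖superposition f u - superposition f v‖ₑ ≤ (D * L : ℝ≥0) * ‖u - v‖ₑ := by
    rw [ENNReal.coe_mul, mul_assoc]
    exact mul_le_mul_right (hL u v (hR u hu) (hR v hv)) _
  refine (hD _ _ hpq).trans ((add_le_add hlow_le ((sobolevNorm_add_le _ _ _).trans
    (add_le_add ((sobolevNorm_add_le _ _ _).trans (add_le_add hp_le hq_le)) hlin_le))).trans ?_)
  rw [← add_assoc, ← add_assoc, mul_add, mul_add, mul_add]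
  gcongr

theorem SuperpositionBound.exists_sobolevNorm_le {s : ℝ} (hs : 0 ≤ s) {f : ℝ → ℝ}
    (hf : ContDiff ℝ 1 f) (hf0 : f 0 = 0) (h : SuperpositionBound s f) (M : ℝ≥0) :
    ∃ K : ℝ≥0, ∀ u, sobolevNorm s u ≤ M → sobolevNorm s (superposition f u) ≤ K := by
  obtain ⟨L, hL⟩ := h M
  obtain ⟨C, hC⟩ := hL 1 one_pos
  refine ⟨L * (M + 1) + C * M, fun u hu => ?_⟩
  have hzero : sobolevNorm s 0 ≤ M := by
    have := sobolevNorm_smul s 0 0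
    simp_all
  have hu0 := hC u 0 hu hzero
  rw [superposition_zero hf hf0, sub_zero, sub_zero] at hu0
  refine hu0.trans ?_
  push_cast
  gcongr
  exact (enorm_le_sobolevNorm hs u).trans hu

theorem superpositionBound_of_centeredDeriv {s a : ℝ} (hs : 1 ≤ s) (ha : 1 / 2 < a)
    (hsa : s - 1 ≤ a) (has : a ≤ s) {f : ℝ → ℝ} (hf : ContDiff ℝ 2 f) (hf0 : f 0 = 0)
    (hg : SuperpositionBound a (centeredDeriv f)) : SuperpositionBound s f := by
  intro M
  obtain ⟨C, hC⟩ := exists_sobolevNorm_superposition_sub_le hs ha hsa hf hf0 M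
  obtain ⟨K, hK⟩ := hg.exists_sobolevNorm_le (by linarith) (contDiff_centeredDeriv (n := 1) hf)
    (centeredDeriv_zero f) M
  obtain ⟨L, hL⟩ := hg M
  refine ⟨C * (K + L * M + 1), fun ε hε => ?_⟩
  obtain ⟨B, hB⟩ := hL ε hε
  refine ⟨C * (1 + B * M), fun u v hu hv => ?_⟩
  have hua := (sobolevNorm_mono has u).trans hu
  have hva := (sobolevNorm_mono has v).trans hv
  have hKu := hK u hua
  have hgsub := (hB u v hua hva).trans
    (add_le_add_left (mul_le_mul_right (add_le_add_left (sobolevNorm_mono has (u - v)) _) _) _)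
  calc sobolevNorm s (superposition f u - superposition f v)
      ≤ C * (‖u - v‖ₑ + K * (sobolevNorm s (u - v) + ε) +
          (L * (sobolevNorm s (u - v) + ε) + B * ‖u - v‖ₑ) * M + (sobolevNorm s (u - v) + ε)) := by
        refine (hC u v hu hv (hKu.trans_lt ENNReal.coe_lt_top)
          ((hK v hva).trans_lt ENNReal.coe_lt_top)).trans ?_
        gcongr <;> exact le_self_add
    _ = _ := by
        push_cast
        ring

theorem superpositionBound (n : ℕ) : ∀ {s : ℝ}, 1 / 2 < s → s < n + 1 → ∀ {f : ℝ → ℝ},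
    ContDiff ℝ (n + 1) f → f 0 = 0 → SuperpositionBound s f := by
  induction n with
  | zero =>
    intro s hs hs1 f hf hf0
    exact superpositionBound_of_lt_one hs (by simpa using hs1) (by simpa using hf) hf0
  | succ n ih =>
    intro s hs hsn f hf hf0
    rcases lt_or_ge s 1 with h | h
    · exact superpositionBound_of_lt_one hs h (hf.of_le le_add_self) hf0
    push_cast at hsn hf
    have hf2 : ContDiff ℝ 2 f := hf.of_le (by
      rw [← one_add_one_eq_two]
      exact add_le_add_left le_add_self 1)
    have hmax : max (s - 1) (3 / 4) < (n : ℝ) + 1 :=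
      max_lt (by linarith) (by linarith [n.cast_nonneg (α := ℝ)])
    exact superpositionBound_of_centeredDeriv h (lt_max_of_lt_right (by norm_num))
      (le_max_left _ _) (max_le (by linarith) (by linarith)) hf2 hf0
      (ih (lt_max_of_lt_right (by norm_num)) hmax
        (by exact_mod_cast contDiff_centeredDeriv (n := n + 1) (by exact_mod_cast hf))
        (centeredDeriv_zero f))

/-! ### Ordinary differential equations with weakly Lipschitz right-hand side -/

section WeaklyLipschitz

variable {H E : Type*} [NormedAddCommGroup H] [NormedSpace ℝ H] [NormedAddCommGroup E]
  [NormedSpace ℝ E]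

/-- `F` is Lipschitz continuous on `s` with constant `K` for the weaker norm `‖J ·‖`, and also for
the norm of `H` up to an arbitrarily small error and a multiple of the weaker norm. -/
structure WeaklyLipschitzOnWith (J : H →L[ℝ] E) (K : ℝ≥0) (F : H → H) (s : Set H) : Prop where
  weak : ∀ x ∈ s, ∀ y ∈ s, ‖J (F x - F y)‖ ≤ K * ‖J (x - y)‖
  strong : ∀ ε : ℝ, 0 < ε → ∃ C : ℝ≥0, ∀ x ∈ s, ∀ y ∈ s,
    ‖F x - F y‖ ≤ K * (‖x - y‖ + ε) + C * ‖J (x - y)‖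

theorem tendsto_zero_of_eventually_le_mul_add {a : ℕ → ℝ} (ha : ∀ n, 0 ≤ a n) {K : ℝ≥0}
    (hK : K < 1) (h : ∀ ε > 0, ∀ᶠ n in atTop, a (n + 1) ≤ K * a n + ε) :
    Tendsto a atTop (𝓝 0) := by
  have hK' : (0 : ℝ) < 1 - K := sub_pos.2 hK
  refine (tendsto_order.2 ⟨fun b hb => .of_forall fun n => hb.trans_le (ha n), fun b hb => ?_⟩)
  obtain ⟨N, hN⟩ := eventually_atTop.1 (h ((1 - K) * (b / 2)) (by positivity))
  have hgeom (k : ℕ) : a (k + N) ≤ K ^ k * a N + b / 2 := by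
    induction k with
    | zero =>
      rw [zero_add, pow_zero, one_mul]
      linarith
    | succ k ih =>
      rw [Nat.add_right_comm]
      calc a (k + N + 1) ≤ K * a (k + N) + (1 - K) * (b / 2) := hN _ (Nat.le_add_left N k)
        _ ≤ K * (K ^ k * a N + b / 2) + (1 - K) * (b / 2) := by gcongr
        _ = K ^ (k + 1) * a N + b / 2 := by ring
  have hpow : Tendsto (fun k : ℕ => (K : ℝ) ^ k * a N) atTop (𝓝 (0 * a N)) :=
    (tendsto_pow_atTop_nhds_zero_of_lt_one K.coe_nonneg hK).mul_const _
  rw [zero_mul] at hpow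
  rw [← map_add_atTop_eq_nat N, eventually_map]
  filter_upwards [hpow.eventually_lt_const (half_pos hb)] with k hk
  linarith [hgeom k]

namespace WeaklyLipschitzOnWith

variable {J : H →L[ℝ] E} {K : ℝ≥0} {F : H → H} {s : Set H}

theorem uniformContinuousOn (h : WeaklyLipschitzOnWith J K F s) : UniformContinuousOn F s := by
  rw [Metric.uniformContinuousOn_iff]
  intro ε hε
  obtain ⟨C, hC⟩ := h.strong (ε / (2 * (K + 1))) (by positivity)
  refine ⟨ε / (2 * (K + C * ‖J‖ + 1)), by positivity, fun x hx y hy hxy => ?_⟩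
  rw [dist_eq_norm] at hxy ⊢
  have hJ := J.le_opNorm (x - y)
  have hsmall : (K : ℝ) * (ε / (2 * (K + 1))) ≤ ε / 2 := by
    rw [mul_div_assoc', div_le_iff₀ (by positivity)]
    nlinarith
  have hlin : (K + C * ‖J‖) * ‖x - y‖ < ε / 2 := by
    rw [lt_div_iff₀ (by positivity)] at hxy
    linarith [norm_nonneg (x - y)]
  calc ‖F x - F y‖ ≤ K * (‖x - y‖ + ε / (2 * (K + 1))) + C * (‖J‖ * ‖x - y‖) := by
        refine (hC x hx y hy).trans ?_
        gcongr
    _ < ε := by linarith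

theorem norm_map_sub_le (h : WeaklyLipschitzOnWith J K F s) {x y : H} (hx : x ∈ s) (hy : y ∈ s) :
    (1 - K) * ‖J (x - y)‖ ≤ ‖J‖ * ‖x - F x - (y - F y)‖ := by
  have hsplit : x - y = x - F x - (y - F y) + (F x - F y) := by abel
  have hJ : ‖J (x - y)‖ ≤ ‖J‖ * ‖x - F x - (y - F y)‖ + K * ‖J (x - y)‖ := by
    conv_lhs => rw [hsplit, map_add]
    exact norm_add_le_of_le (J.le_opNorm _) (h.weak x hx y hy)
  linarith

theorem exists_norm_sub_lt (h : WeaklyLipschitzOnWith J K F s) (hK : K < 1) {ε : ℝ} (hε : 0 < ε) :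
    ∃ δ > 0, ∀ x ∈ s, ∀ y ∈ s, ‖x - F x - (y - F y)‖ < δ → ‖x - y‖ < ε := by
  have hK' : (0 : ℝ) < 1 - K := sub_pos.2 hK
  obtain ⟨C, hC⟩ := h.strong ((1 - K) * (ε / 2)) (by positivity)
  refine ⟨(1 - K) ^ 2 * (ε / 2) / (1 + C * ‖J‖), by positivity, fun x hx y hy hxy => ?_⟩
  rw [lt_div_iff₀ (by positivity)] at hxy
  have hstrong : (1 - K) * ‖x - y‖ ≤
      ‖x - F x - (y - F y)‖ + K * ((1 - K) * (ε / 2)) + C * ‖J (x - y)‖ := by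
    have hsplit := norm_add_le (x - F x - (y - F y)) (F x - F y)
    rw [show x - F x - (y - F y) + (F x - F y) = x - y by abel] at hsplit
    linarith [hC x hx y hy]
  have hweak := mul_le_mul_of_nonneg_left (h.norm_map_sub_le hx hy) C.coe_nonneg
  refine lt_of_mul_lt_mul_left (a := (1 - K : ℝ) ^ 2) ?_ (by positivity)
  calc (1 - K : ℝ) ^ 2 * ‖x - y‖ = (1 - K) * ((1 - K) * ‖x - y‖) := by ring
    _ ≤ (1 - K) * (‖x - F x - (y - F y)‖ + K * ((1 - K) * (ε / 2)) + C * ‖J (x - y)‖) := by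
        gcongr
    _ = (1 - K) * ‖x - F x - (y - F y)‖ + K * ((1 - K) ^ 2 * (ε / 2)) +
          C * ((1 - K) * ‖J (x - y)‖) := by ring
    _ ≤ 1 * ‖x - F x - (y - F y)‖ + 1 * ((1 - K) ^ 2 * (ε / 2)) +
          C * (‖J‖ * ‖x - F x - (y - F y)‖) := by
        gcongr
        · linarith
        · exact_mod_cast hK.le
    _ < (1 - K) ^ 2 * ε := by linarith

theorem norm_map_iterate_sub_le (h : WeaklyLipschitzOnWith J K F s) (hF : MapsTo F s s) {x : H}
    (hx : x ∈ s) (n : ℕ) : ‖J (F^[n] x - F^[n + 1] x)‖ ≤ K ^ n * ‖J (x - F x)‖ := by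
  induction n with
  | zero => rw [pow_zero, one_mul, zero_add, Function.iterate_zero_apply, Function.iterate_one]
  | succ n ih =>
    rw [Function.iterate_succ_apply' F n, Function.iterate_succ_apply' F (n + 1), pow_succ',
      mul_assoc]
    exact (h.weak _ (hF.iterate n hx) _ (hF.iterate (n + 1) hx)).trans (by gcongr)

theorem tendsto_norm_iterate_sub (h : WeaklyLipschitzOnWith J K F s) (hK : K < 1)
    (hF : MapsTo F s s) {x : H} (hx : x ∈ s) :
    Tendsto (fun n => ‖F^[n] x - F^[n + 1] x‖) atTop (𝓝 0) := by
  refine tendsto_zero_of_eventually_le_mul_add (fun n => norm_nonneg _) hK fun ε hε => ?_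
  obtain ⟨C, hC⟩ := h.strong (ε / 2) (half_pos hε)
  have hpow : Tendsto (fun n => C * ((K : ℝ) ^ n * ‖J (x - F x)‖)) atTop
      (𝓝 (C * (0 * ‖J (x - F x)‖))) :=
    ((tendsto_pow_atTop_nhds_zero_of_lt_one K.coe_nonneg hK).mul_const _).const_mul _
  rw [zero_mul, mul_zero] at hpow
  filter_upwards [hpow.eventually_lt_const (half_pos hε)] with n hn
  have hstrong := hC _ (hF.iterate n hx) _ (hF.iterate (n + 1) hx)
  have hweak := mul_le_mul_of_nonneg_left (h.norm_map_iterate_sub_le hF hx n) C.coe_nonneg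
  have hKε : (K : ℝ) * (ε / 2) ≤ 1 * (ε / 2) := by
    gcongr
    exact_mod_cast hK.le
  rw [← Function.iterate_succ_apply' F, ← Function.iterate_succ_apply' F] at hstrong
  linarith

theorem exists_fixedPoint (h : WeaklyLipschitzOnWith J K F s) (hK : K < 1) (hs : IsComplete s)
    (hF : MapsTo F s s) (hne : s.Nonempty) : ∃ x ∈ s, F x = x := by
  obtain ⟨x₀, hx₀⟩ := hne
  have hmem (n : ℕ) : F^[n] x₀ ∈ s := hF.iterate n hx₀
  have hcauchy : CauchySeq fun n => F^[n] x₀ := by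
    rw [Metric.cauchySeq_iff]
    intro ε hε
    obtain ⟨δ, hδ, hlt⟩ := h.exists_norm_sub_lt hK hε
    obtain ⟨N, hN⟩ := eventually_atTop.1
      ((h.tendsto_norm_iterate_sub hK hF hx₀).eventually_lt_const (half_pos hδ))
    refine ⟨N, fun m hm n hn => ?_⟩
    rw [dist_eq_norm]
    refine hlt _ (hmem m) _ (hmem n) ((norm_sub_le _ _).trans_lt ?_)
    rw [← Function.iterate_succ_apply' F, ← Function.iterate_succ_apply' F]
    linarith [hN m hm, hN n hn]
  obtain ⟨x, hx, hlim⟩ := cauchySeq_tendsto_of_isComplete hs hmem hcauchy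
  have hFlim : Tendsto (fun n => F (F^[n] x₀)) atTop (𝓝 (F x)) :=
    (h.uniformContinuousOn.continuousOn x hx).tendsto.comp
      (tendsto_nhdsWithin_iff.2 ⟨hlim, .of_forall hmem⟩)
  refine ⟨x, hx, tendsto_nhds_unique (hFlim.congr fun n => ?_)
    ((tendsto_add_atTop_iff_nat 1).2 hlim)⟩
  rw [Function.iterate_succ_apply']

end WeaklyLipschitzOnWith

end WeaklyLipschitz

section Picard

variable {H E : Type*} [NormedAddCommGroup H] [NormedSpace ℝ H] [NormedAddCommGroup E]
  [NormedSpace ℝ E]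

/-- The Picard operator of the initial-value problem `x' = F x`, `x 0 = ψ` on `[0, T]`. -/
def picardMap (F : C(H, H)) {T : ℝ} (hT : 0 ≤ T) (ψ : H) (x : C(Icc 0 T, H)) : C(Icc 0 T, H) where
  toFun t := ψ + ∫ τ in (0 : ℝ)..t, F (IccExtend hT x τ)
  continuous_toFun := by
    have hFx : Continuous fun τ => F (IccExtend hT x τ) :=
      F.continuous.comp (x.continuous.Icc_extend' (h := hT))
    exact continuous_const.add ((intervalIntegral.continuous_primitive
      (fun a b => hFx.intervalIntegrable a b) 0).comp continuous_subtype_val)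

variable {F : C(H, H)} {T : ℝ} (hT : 0 ≤ T)

theorem picardMap_apply (ψ : H) (x : C(Icc 0 T, H)) (t : Icc 0 T) :
    picardMap F hT ψ x t = ψ + ∫ τ in (0 : ℝ)..t, F (IccExtend hT x τ) := rfl

theorem picardMap_sub_picardMap (χ ψ : H) (x : C(Icc 0 T, H)) :
    picardMap F hT χ x - picardMap F hT ψ x = ContinuousMap.const _ (χ - ψ) :=
  ContinuousMap.ext fun _ => add_sub_add_right_eq_sub _ _ _

theorem norm_map_picardMap_sub_le [CompleteSpace H] [CompleteSpace E] (A : H →L[ℝ] E) (ψ : H)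
    {x y : C(Icc 0 T, H)} {D : ℝ} (hD : ∀ t, ‖A (F (x t) - F (y t))‖ ≤ D) (t : Icc 0 T) :
    ‖A (picardMap F hT ψ x t - picardMap F hT ψ y t)‖ ≤ T * D := by
  have hint (z : C(Icc 0 T, H)) :
      IntervalIntegrable (fun τ => F (IccExtend hT z τ)) volume 0 t :=
    (F.continuous.comp (z.continuous.Icc_extend' (h := hT))).intervalIntegrable _ _
  have hD0 : 0 ≤ D := (norm_nonneg _).trans (hD t)
  rw [picardMap_apply, picardMap_apply, add_sub_add_left_eq_sub,
    ← intervalIntegral.integral_sub (hint x) (hint y),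
    ← A.intervalIntegral_comp_comm ((hint x).sub (hint y))]
  refine (intervalIntegral.norm_integral_le_of_norm_le_const fun τ _ => hD _).trans ?_
  rw [sub_zero, abs_of_nonneg t.2.1, mul_comm]
  gcongr
  exact t.2.2

theorem weaklyLipschitzOnWith_picardMap [CompleteSpace H] [CompleteSpace E] {J : H →L[ℝ] E}
    {K K' : ℝ≥0} {M : ℝ} (h : WeaklyLipschitzOnWith J K F (Metric.closedBall 0 M))
    (hK : T * K ≤ K') (ψ : H) :
    WeaklyLipschitzOnWith (J.compLeftContinuous ℝ (Icc 0 T)) K' (picardMap F hT ψ)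
      (Metric.closedBall 0 M) := by
  have hmem {x : C(Icc 0 T, H)} (hx : x ∈ Metric.closedBall 0 M) (t : Icc 0 T) :
      x t ∈ Metric.closedBall (0 : H) M := by
    rw [mem_closedBall_zero_iff] at hx ⊢
    exact (x.norm_coe_le_norm t).trans hx
  have hJ (x y : C(Icc 0 T, H)) (t : Icc 0 T) :
      ‖J (x t - y t)‖ ≤ ‖J.compLeftContinuous ℝ (Icc 0 T) (x - y)‖ :=
    (J.compLeftContinuous ℝ (Icc 0 T) (x - y)).norm_coe_le_norm t
  refine ⟨fun x hx y hy => ?_, fun ε hε => ?_⟩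
  · rw [ContinuousMap.norm_le _ (by positivity)]
    intro t
    refine (norm_map_picardMap_sub_le hT J ψ (fun τ =>
      (h.weak _ (hmem hx τ) _ (hmem hy τ)).trans
        (mul_le_mul_of_nonneg_left (hJ x y τ) K.coe_nonneg)) t).trans ?_
    rw [← mul_assoc]
    gcongr
  · obtain ⟨C, hC⟩ := h.strong ε hε
    refine ⟨T.toNNReal * C, fun x hx y hy => ?_⟩
    rw [ContinuousMap.norm_le _ (by positivity)]
    intro t
    refine (norm_map_picardMap_sub_le hT (.id ℝ H) ψ (D := K * (‖x - y‖ + ε) +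
      C * ‖J.compLeftContinuous ℝ (Icc 0 T) (x - y)‖) (fun τ => ?_) t).trans ?_
    · refine (hC _ (hmem hx τ) _ (hmem hy τ)).trans ?_
      gcongr
      exacts [(x - y).norm_coe_le_norm τ, hJ x y τ]
    · rw [mul_add, ← mul_assoc, ← mul_assoc, NNReal.coe_mul, Real.coe_toNNReal T hT]
      gcongr

theorem mapsTo_picardMap {ψ : H} {M D : ℝ} (hD : ∀ u ∈ Metric.closedBall 0 M, ‖F u‖ ≤ D)
    (hM : ‖ψ‖ + T * D ≤ M) :
    MapsTo (picardMap F hT ψ) (Metric.closedBall 0 M) (Metric.closedBall 0 M) := by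
  intro x hx
  rw [mem_closedBall_zero_iff] at hx ⊢
  have hFx (t : Icc 0 T) : ‖F (x t)‖ ≤ D :=
    hD _ (mem_closedBall_zero_iff.2 ((x.norm_coe_le_norm t).trans hx))
  have hD0 : 0 ≤ D := (norm_nonneg _).trans (hFx ⟨0, le_rfl, hT⟩)
  rw [ContinuousMap.norm_le _ ((norm_nonneg x).trans hx)]
  intro t
  refine le_trans (norm_add_le_of_le le_rfl ?_) hM
  refine (intervalIntegral.norm_integral_le_of_norm_le_const fun τ _ => hFx _).trans ?_
  rw [sub_zero, abs_of_nonneg t.2.1, mul_comm]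
  gcongr
  exact t.2.2

theorem hasDerivWithinAt_of_picardMap_eq [CompleteSpace H] {ψ : H} {x : C(Icc 0 T, H)}
    (hx : picardMap F hT ψ x = x) {t : ℝ} (ht : t ∈ Icc 0 T) :
    HasDerivWithinAt (IccExtend hT x) (F (IccExtend hT x t)) (Icc 0 T) t := by
  have hFx : Continuous fun τ => F (IccExtend hT x τ) :=
    F.continuous.comp (x.continuous.Icc_extend' (h := hT))
  have heq : EqOn (IccExtend hT x) (fun t => ψ + ∫ τ in (0 : ℝ)..t, F (IccExtend hT x τ))
      (Icc 0 T) := fun t ht => by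
    rw [IccExtend_of_mem hT x ht]
    exact (DFunLike.congr_fun hx ⟨t, ht⟩).symm
  exact ((intervalIntegral.integral_hasDerivAt_right (hFx.intervalIntegrable _ _)
    (hFx.stronglyMeasurableAtFilter _ _) hFx.continuousAt).const_add ψ).hasDerivWithinAt.congr
      heq (heq ht)

/-- `F` is weakly Lipschitz continuous on every ball of `H`. -/
def LocallyWeaklyLipschitz (J : H →L[ℝ] E) (F : H → H) : Prop :=
  ∀ M : ℝ, ∃ K : ℝ≥0, WeaklyLipschitzOnWith J K F (Metric.closedBall 0 M)

namespace LocallyWeaklyLipschitz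

variable {J : H →L[ℝ] E} {F : H → H}

theorem continuous (h : LocallyWeaklyLipschitz J F) : Continuous F := by
  rw [continuous_iff_continuousAt]
  intro u
  obtain ⟨K, hK⟩ := h (‖u‖ + 1)
  refine hK.uniformContinuousOn.continuousOn.continuousAt (Filter.mem_of_superset ?_
    Metric.ball_subset_closedBall)
  exact Metric.isOpen_ball.mem_nhds (mem_ball_zero_iff.2 (lt_add_one _))

theorem exists_norm_le (h : LocallyWeaklyLipschitz J F) (M : ℝ) :
    ∃ D : ℝ≥0, ∀ u ∈ Metric.closedBall 0 M, ‖F u‖ ≤ D := by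
  obtain ⟨K, hK⟩ := h (max M 0)
  obtain ⟨C, hC⟩ := hK.strong 1 one_pos
  refine ⟨‖F 0‖₊ + K * (M.toNNReal + 1) + C * (‖J‖₊ * M.toNNReal), fun u hu => ?_⟩
  have h0 : (0 : H) ∈ Metric.closedBall 0 (max M 0) := by simp
  have hstrong := hC u (Metric.closedBall_subset_closedBall (le_max_left M 0) hu) 0 h0
  rw [mem_closedBall_zero_iff] at hu
  rw [sub_zero] at hstrong
  have hM : (M.toNNReal : ℝ) = M := Real.coe_toNNReal M ((norm_nonneg u).trans hu)
  push_cast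
  rw [hM]
  calc ‖F u‖ ≤ ‖F 0‖ + ‖F u - F 0‖ := norm_le_norm_add_norm_sub' _ _
    _ ≤ ‖F 0‖ + (K * (‖u‖ + 1) + C * (‖J‖ * ‖u‖)) := by
        gcongr
        exact hstrong.trans (by gcongr; exact J.le_opNorm u)
    _ ≤ ‖F 0‖ + K * (M + 1) + C * (‖J‖ * M) := by
        rw [← add_assoc]
        gcongr

theorem eqOn (h : LocallyWeaklyLipschitz J F) (hJ : Function.Injective J) {T : ℝ}
    {x y : ℝ → H} (hx : ∀ t ∈ Icc 0 T, HasDerivWithinAt x (F (x t)) (Icc 0 T) t)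
    (hy : ∀ t ∈ Icc 0 T, HasDerivWithinAt y (F (y t)) (Icc 0 T) t) (h0 : x 0 = y 0) :
    EqOn x y (Icc 0 T) := by
  have hxc : ContinuousOn x (Icc 0 T) := fun t ht => (hx t ht).continuousWithinAt
  have hyc : ContinuousOn y (Icc 0 T) := fun t ht => (hy t ht).continuousWithinAt
  obtain ⟨M, hM⟩ := isCompact_Icc.exists_bound_of_continuousOn (hxc.prodMk hyc)
  obtain ⟨K, hK⟩ := h M
  have hJ0 : ∀ t ∈ Icc 0 T, J (x t - y t) = 0 := by
    refine eq_zero_of_abs_deriv_le_mul_abs_self_of_eq_zero_right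
      (f' := fun t => J (F (x t) - F (y t))) (K := K)
      (J.continuous.comp_continuousOn (hxc.sub hyc)) (fun t ht => ?_)
      (by rw [h0, sub_self, map_zero]) fun t ht => ?_
    · have ht' := Ico_subset_Icc_self ht
      exact (J.hasFDerivAt.comp_hasDerivWithinAt t ((hx t ht').sub (hy t ht')))
        |>.mono_of_mem_nhdsWithin (Icc_mem_nhdsGE_of_mem ht)
    · have hMt := hM t (Ico_subset_Icc_self ht)
      rw [Prod.norm_mk, max_le_iff] at hMt
      exact hK.weak _ (mem_closedBall_zero_iff.2 hMt.1) _ (mem_closedBall_zero_iff.2 hMt.2)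
  exact fun t ht => sub_eq_zero.1 (hJ ((hJ0 t ht).trans J.map_zero.symm))

theorem exists_picardTime [CompleteSpace H] [CompleteSpace E] {F : C(H, H)}
    (h : LocallyWeaklyLipschitz J F) (M : ℝ) :
    ∃ T, ∃ hT : 0 < T, ∀ ψ,
      WeaklyLipschitzOnWith (J.compLeftContinuous ℝ (Icc 0 T)) (1 / 2) (picardMap F hT.le ψ)
        (Metric.closedBall 0 M) ∧
      (‖ψ‖ + 1 ≤ M →
        MapsTo (picardMap F hT.le ψ) (Metric.closedBall 0 M) (Metric.closedBall 0 M)) := by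
  obtain ⟨K, hK⟩ := h M
  obtain ⟨D, hD⟩ := h.exists_norm_le M
  have hT : 0 < (2 * K + D + 1 : ℝ)⁻¹ := by positivity
  refine ⟨(2 * K + D + 1 : ℝ)⁻¹, hT, fun ψ => ⟨weaklyLipschitzOnWith_picardMap hT.le hK ?_ ψ,
    fun hψ => mapsTo_picardMap hT.le hD (hψ.trans' ?_)⟩⟩
  · rw [inv_mul_le_iff₀ (by positivity)]
    push_cast
    linarith [D.coe_nonneg]
  · gcongr
    rw [inv_mul_le_iff₀ (by positivity)]
    linarith [K.coe_nonneg]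

theorem exists_solutionMap [CompleteSpace H] [CompleteSpace E] {F : C(H, H)}
    (h : LocallyWeaklyLipschitz J F) (φ : H) :
    ∃ T, ∃ hT : 0 < T, ∃ S : H → C(Icc 0 T, H),
      (∀ ψ ∈ Metric.ball φ 1, picardMap F hT.le ψ (S ψ) = S ψ) ∧
      MapsTo S (Metric.ball φ 1) (Metric.closedBall 0 (‖φ‖ + 2)) ∧
      UniformContinuousOn S (Metric.ball φ 1) := by
  obtain ⟨T, hT, hpicard⟩ := h.exists_picardTime (‖φ‖ + 2)
  have hhalf : (1 / 2 : ℝ≥0) < 1 := half_lt_self one_pos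
  have hex (ψ : H) (hψ : ψ ∈ Metric.ball φ 1) :
      ∃ x ∈ Metric.closedBall 0 (‖φ‖ + 2), picardMap F hT.le ψ x = x := by
    have hψ' : ‖ψ‖ + 1 ≤ ‖φ‖ + 2 := by
      linarith [mem_ball_iff_norm.1 hψ, norm_le_norm_add_norm_sub' ψ φ]
    exact (hpicard ψ).1.exists_fixedPoint hhalf Metric.isClosed_closedBall.isComplete
      ((hpicard ψ).2 hψ') ⟨0, Metric.mem_closedBall_self (by positivity)⟩
  choose! S hSmem hSfix using hex
  refine ⟨T, hT, S, hSfix, hSmem, Metric.uniformContinuousOn_iff.2 fun ε hε => ?_⟩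
  obtain ⟨δ, hδ, hlt⟩ := (hpicard φ).1.exists_norm_sub_lt hhalf hε
  refine ⟨δ, hδ, fun χ hχ ψ hψ hdist => ?_⟩
  have hdefect (ξ : H) (hξ : ξ ∈ Metric.ball φ 1) :
      S ξ - picardMap F hT.le φ (S ξ) = ContinuousMap.const _ (ξ - φ) := by
    rw [← picardMap_sub_picardMap hT.le ξ φ (S ξ), hSfix ξ hξ]
  rw [dist_eq_norm] at hdist ⊢
  refine hlt _ (hSmem χ hχ) _ (hSmem ψ hψ) ?_
  have hconst : ContinuousMap.const (Icc 0 T) (χ - φ) - ContinuousMap.const _ (ψ - φ) =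
      ContinuousMap.const _ (χ - ψ) := ContinuousMap.ext fun _ => sub_sub_sub_cancel_right _ _ _
  rw [hdefect χ hχ, hdefect ψ hψ, hconst]
  exact ((ContinuousMap.norm_le _ (norm_nonneg _)).2 fun _ => le_rfl).trans_lt hdist

theorem wellPosed [CompleteSpace H] [CompleteSpace E] (h : LocallyWeaklyLipschitz J F)
    (hJ : Function.Injective J) (φ : H) :
    ∃ T > 0, ∃ S : H → ℝ → H,
      (∀ ψ ∈ Metric.ball φ 1, S ψ 0 = ψ ∧
        ∀ t ∈ Icc 0 T, HasDerivWithinAt (S ψ) (F (S ψ t)) (Icc 0 T) t) ∧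
      (∀ ψ ∈ Metric.ball φ 1, ∀ T' ≤ T, ∀ v : ℝ → H, v 0 = ψ →
        (∀ t ∈ Icc 0 T', HasDerivWithinAt v (F (v t)) (Icc 0 T') t) → EqOn v (S ψ) (Icc 0 T')) ∧
      ∀ ε > 0, ∃ δ > 0, ∀ χ ∈ Metric.ball φ 1, ∀ ψ ∈ Metric.ball φ 1, ‖χ - ψ‖ < δ →
        ∀ t, ‖S χ t - S ψ t‖ < ε ∧ ‖F (S χ t) - F (S ψ t)‖ < ε := by
  lift F to C(H, H) using h.continuous
  obtain ⟨T, hT, S, hSfix, hSmem, hScont⟩ := h.exists_solutionMap φ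
  have hinit (ψ : H) (hψ : ψ ∈ Metric.ball φ 1) : IccExtend hT.le (S ψ) 0 = ψ := by
    rw [IccExtend_left, ← hSfix ψ hψ, picardMap_apply, intervalIntegral.integral_same, add_zero]
  have hderiv (ψ : H) (hψ : ψ ∈ Metric.ball φ 1) (t : ℝ) (ht : t ∈ Icc 0 T) :=
    hasDerivWithinAt_of_picardMap_eq hT.le (hSfix ψ hψ) ht
  refine ⟨T, hT, fun ψ => IccExtend hT.le (S ψ), fun ψ hψ => ⟨hinit ψ hψ, hderiv ψ hψ⟩,
    fun ψ hψ T' hT' v hv0 hv => h.eqOn hJ hv (fun t ht => ?_) (hv0.trans (hinit ψ hψ).symm),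
    fun ε hε => ?_⟩
  · exact (hderiv ψ hψ t ⟨ht.1, ht.2.trans hT'⟩).mono (Icc_subset_Icc_right hT')
  · obtain ⟨K, hK⟩ := h (‖φ‖ + 2)
    obtain ⟨η, hη, hFη⟩ := Metric.uniformContinuousOn_iff.1 hK.uniformContinuousOn ε hε
    obtain ⟨δ, hδ, hSδ⟩ := Metric.uniformContinuousOn_iff.1 hScont (min ε η) (lt_min hε hη)
    have hmem {ψ : H} (hψ : ψ ∈ Metric.ball φ 1) (t : ℝ) :
        IccExtend hT.le (S ψ) t ∈ Metric.closedBall 0 (‖φ‖ + 2) :=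
      mem_closedBall_zero_iff.2
        (((S ψ).norm_coe_le_norm _).trans (mem_closedBall_zero_iff.1 (hSmem hψ)))
    refine ⟨δ, hδ, fun χ hχ ψ hψ hχψ t => ?_⟩
    rw [← dist_eq_norm] at hχψ
    have hlt (τ : Icc 0 T) : dist (S χ τ) (S ψ τ) < min ε η :=
      (ContinuousMap.dist_apply_le_dist τ).trans_lt (hSδ χ hχ ψ hψ hχψ)
    rw [← dist_eq_norm, ← dist_eq_norm]
    exact ⟨(hlt _).trans_le (min_le_left _ _),
      hFη _ (hmem hχ t) _ (hmem hψ t) ((hlt _).trans_le (min_le_right _ _))⟩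

theorem comp_left (h : LocallyWeaklyLipschitz J F) {A : H →L[ℝ] H} {B : E →L[ℝ] E}
    (hAB : ∀ x, J (A x) = B (J x)) : LocallyWeaklyLipschitz J fun x => A (F x) := by
  intro M
  obtain ⟨K, hK⟩ := h M
  refine ⟨max ‖A‖₊ ‖B‖₊ * K, fun x hx y hy => ?_, fun ε hε => ?_⟩
  · calc ‖J (A (F x) - A (F y))‖ ≤ ‖B‖ * ‖J (F x - F y)‖ := by
          rw [← map_sub, hAB]
          exact B.le_opNorm _
      _ ≤ max ‖A‖ ‖B‖ * (K * ‖J (x - y)‖) := by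
          gcongr
          exacts [le_max_right _ _, hK.weak x hx y hy]
      _ = (max ‖A‖₊ ‖B‖₊ * K : ℝ≥0) * ‖J (x - y)‖ := by
          push_cast
          ring
  · obtain ⟨C, hC⟩ := hK.strong ε hε
    refine ⟨max ‖A‖₊ ‖B‖₊ * C, fun x hx y hy => ?_⟩
    calc ‖A (F x) - A (F y)‖ ≤ ‖A‖ * ‖F x - F y‖ := by
          rw [← map_sub]
          exact A.le_opNorm _
      _ ≤ max ‖A‖ ‖B‖ * (K * (‖x - y‖ + ε) + C * ‖J (x - y)‖) := by
          gcongr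
          exacts [le_max_left _ _, hC x hx y hy]
      _ = (max ‖A‖₊ ‖B‖₊ * K : ℝ≥0) * (‖x - y‖ + ε) +
          (max ‖A‖₊ ‖B‖₊ * C : ℝ≥0) * ‖J (x - y)‖ := by
          push_cast
          ring

end LocallyWeaklyLipschitz

end Picard

/-! ### Distributional derivatives and convolution with a measure -/

section WeakDerivative

variable {v g g' : ℝ → ℝ}

theorem HasWeakDeriv.ae_eq (h : HasWeakDeriv v g) (h' : HasWeakDeriv v g') :
    g =ᵐ[volume] g' := by
  refine ae_eq_of_integral_contDiff_smul_eq h.2.1 h'.2.1 fun θ hθ hθc => ?_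
  simp only [smul_eq_mul, mul_comm (θ _)]
  exact neg_injective ((h.2.2 θ hθ hθc).symm.trans (h'.2.2 θ hθ hθc))

theorem HasWeakDeriv.congr_ae (h : HasWeakDeriv v g) (hg : g =ᵐ[volume] g') :
    HasWeakDeriv v g' :=
  ⟨h.1, h.2.1.congr hg, fun θ hθ hθc =>
    (h.2.2 θ hθ hθc).trans (congrArg Neg.neg (integral_congr_ae (hg.mul .rfl)))⟩

theorem integral_convolution_mul_deriv {β V θ : ℝ → ℝ} {μ : SignedMeasure ℝ} (hβ : Integrable β)
    (hμ : HasMeasureDeriv β μ) (hV : MemLp V 2) (hθ : ContDiff ℝ ∞ θ) (hθc : HasCompactSupport θ) :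
    ∫ x, (β ⋆[mul ℝ ℝ, volume] V) x * deriv θ x =
      -((∫ x, θ x * ((1 : ℝ → ℝ) ⋆[mul ℝ ℝ, μ.toJordanDecomposition.posPart] V) x) -
        ∫ x, θ x * ((1 : ℝ → ℝ) ⋆[mul ℝ ℝ, μ.toJordanDecomposition.negPart] V) x) := by
  have hθ2 : MemLp θ 2 := hθ.continuous.memLp_of_hasCompactSupport hθc
  have hθ'2 : MemLp (deriv θ) 2 :=
    (hθ.continuous_deriv (by simp)).memLp_of_hasCompactSupport hθc.deriv
  have hone (ν : Measure ℝ) [IsFiniteMeasure ν] : Integrable (1 : ℝ → ℝ) ν := integrable_const 1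
  have htest (x : ℝ) : ∫ t, β t * deriv θ (x + t) =
      -((∫ t, (1 : ℝ → ℝ) t * θ (x + t) ∂μ.toJordanDecomposition.posPart) -
        ∫ t, (1 : ℝ → ℝ) t * θ (x + t) ∂μ.toJordanDecomposition.negPart) := by
    simpa [deriv_comp_const_add] using hμ.2 (fun t => θ (x + t)) (by fun_prop)
      (hθc.comp_homeomorph (Homeomorph.addLeft x))
  calc ∫ x, (β ⋆[mul ℝ ℝ, volume] V) x * deriv θ x
      = ∫ x, V x * ∫ t, β t * deriv θ (x + t) := by
        rw [integral_mul_integral_comp_add hθ'2 hβ hV]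
        simp only [mul_comm]
    _ = _ := by
        simp only [htest, mul_neg, mul_sub]
        rw [integral_neg, integral_sub (integrable_mul_integral_comp_add hθ2 (hone _) hV)
          (integrable_mul_integral_comp_add hθ2 (hone _) hV),
          integral_mul_integral_comp_add hθ2 (hone _) hV,
          integral_mul_integral_comp_add hθ2 (hone _) hV]

end WeakDerivative

section MeasureConvolution

variable {E E' : Type*} [NormedAddCommGroup E] [NormedSpace ℝ E] [NormedAddCommGroup E']
  [NormedSpace ℝ E']

/-- A strongly continuous family of isometries of `E`, such as the translations of a function
space. -/
structure IsometryFamily (E : Type*) [NormedAddCommGroup E] [NormedSpace ℝ E] where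
  toFun : ℝ → E →ₗᵢ[ℝ] E
  continuous_apply : ∀ x, Continuous fun h => toFun h x

namespace IsometryFamily

variable (τ : IsometryFamily E) (τ' : IsometryFamily E')

theorem integrable (ν : Measure ℝ) [IsFiniteMeasure ν] (x : E) :
    Integrable (fun z => τ.toFun (-z) x) ν :=
  .of_bound ((τ.continuous_apply x).comp continuous_neg).aestronglyMeasurable ‖x‖
    (ae_of_all _ fun z => ((τ.toFun (-z)).norm_map x).le)

/-- The convolution with a finite measure `ν`, when `τ` consists of the translations
`(τ h u)(x) = u(x + h)`. -/
def conv (ν : Measure ℝ) [IsFiniteMeasure ν] : E →L[ℝ] E :=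
  LinearMap.mkContinuous
    { toFun x := ∫ z, τ.toFun (-z) x ∂ν
      map_add' x y := by
        simp only [map_add]
        exact integral_add (τ.integrable ν x) (τ.integrable ν y)
      map_smul' c x := by
        simp only [map_smul]
        exact integral_smul c _ }
    (ν.real univ) fun x => (norm_integral_le_of_norm_le_const
      (ae_of_all _ fun z => ((τ.toFun (-z)).norm_map x).le)).trans_eq (mul_comm _ _)

theorem conv_apply (ν : Measure ℝ) [IsFiniteMeasure ν] (x : E) :
    τ.conv ν x = ∫ z, τ.toFun (-z) x ∂ν := rfl

/-- The convolution with a signed measure, when `τ` consists of the translations. -/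
def signedConv (μ : SignedMeasure ℝ) : E →L[ℝ] E :=
  τ.conv μ.toJordanDecomposition.posPart - τ.conv μ.toJordanDecomposition.negPart

variable {τ τ'} [CompleteSpace E] [CompleteSpace E'] {J : E →L[ℝ] E'}

theorem map_conv (hJ : ∀ h x, J (τ.toFun h x) = τ'.toFun h (J x)) (ν : Measure ℝ)
    [IsFiniteMeasure ν] (x : E) : J (τ.conv ν x) = τ'.conv ν (J x) := by
  rw [conv_apply, conv_apply, ← J.integral_comp_comm (τ.integrable ν x)]
  simp only [hJ]

theorem map_signedConv (hJ : ∀ h x, J (τ.toFun h x) = τ'.toFun h (J x)) (μ : SignedMeasure ℝ)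
    (x : E) : J (τ.signedConv μ x) = τ'.signedConv μ (J x) := by
  simp only [signedConv, sub_apply, map_sub, map_conv hJ]

end IsometryFamily

/-- The translations of `L²(ℝ)`. -/
def translationsL2 : IsometryFamily RealL2 := ⟨translateL2, continuous_translateL2⟩

/-- The translations of `H^s(ℝ)`. -/
def SobolevH.translations (s : ℝ) : IsometryFamily (SobolevH s) :=
  ⟨translateH, continuous_translateH⟩

theorem integral_mul_conv {θ : ℝ → ℝ} (hθ : MemLp θ 2) (ν : Measure ℝ) [IsFiniteMeasure ν]
    (w : RealL2) :
    ∫ x, θ x * translationsL2.conv ν w x = ∫ x, θ x * ((1 : ℝ → ℝ) ⋆[mul ℝ ℝ, ν] w) x := by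
  have hinner (w : RealL2) : innerSL ℝ hθ.toLp w = ∫ x, θ x * w x := by
    rw [innerSL_apply_apply, L2.inner_def]
    apply integral_congr_ae
    filter_upwards [hθ.coeFn_toLp] with x hx
    simp [hx, mul_comm]
  calc ∫ x, θ x * translationsL2.conv ν w x
      = ∫ z, innerSL ℝ hθ.toLp (translateL2 (-z) w) ∂ν := by
        rw [← hinner, IsometryFamily.conv_apply]
        exact ((innerSL ℝ hθ.toLp).integral_comp_comm (translationsL2.integrable ν w)).symm
    _ = ∫ z, (1 : ℝ → ℝ) z * (∫ x, θ x * w (x - z)) ∂ν := by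
        congr 1 with z
        rw [hinner, Pi.one_apply, one_mul]
        exact integral_congr_ae (Filter.EventuallyEq.rfl.mul (coeFn_translateL2 (-z) w))
    _ = ∫ x, θ x * ((1 : ℝ → ℝ) ⋆[mul ℝ ℝ, ν] w) x :=
        (integral_mul_convolution (G := 1) hθ (integrable_const 1) (Lp.memLp w)).symm

theorem hasWeakDeriv_convolution {β : ℝ → ℝ} {μ : SignedMeasure ℝ} (hβ : Integrable β)
    (hμ : HasMeasureDeriv β μ) (w : RealL2) :
    HasWeakDeriv (β ⋆[mul ℝ ℝ, volume] w) (translationsL2.signedConv μ w) := by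
  refine ⟨locallyIntegrable_convolution hβ (Lp.memLp w), (Lp.memLp _).locallyIntegrable one_le_two,
    fun θ hθ hθc => ?_⟩
  have hθ2 : MemLp θ 2 := hθ.continuous.memLp_of_hasCompactSupport hθc
  have hint (v : RealL2) : Integrable fun x => θ x * v x := hθ2.integrable_mul (Lp.memLp v)
  rw [integral_convolution_mul_deriv hβ hμ (Lp.memLp w) hθ hθc, ← integral_mul_conv hθ2,
    ← integral_mul_conv hθ2,
    ← integral_sub (hint _) (hint _)]
  refine congrArg Neg.neg (integral_congr_ae ?_)
  filter_upwards [Lp.coeFn_sub (translationsL2.conv μ.toJordanDecomposition.posPart w)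
    (translationsL2.conv μ.toJordanDecomposition.negPart w)] with x hx
  rw [IsometryFamily.signedConv, sub_apply, hx, Pi.sub_apply]
  ring

end MeasureConvolution

/-! ### The evolution equation -/

section Evolution

variable {s : ℝ} {f β : ℝ → ℝ} {μ : SignedMeasure ℝ}

namespace SobolevH

theorem sobolevNorm_toL2_le_iff {u : SobolevH s} {M : ℝ≥0} :
    sobolevNorm s (toL2 u) ≤ M ↔ ‖u‖ ≤ M := by
  rw [← enorm_eq_sobolevNorm, enorm_le_coe, ← NNReal.coe_le_coe, coe_nnnorm]

theorem exists_ae_abs_le_of_norm_le (hs : 1 / 2 < s) (M : ℝ) :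
    ∃ R : ℝ≥0, ∀ u : SobolevH s, ‖u‖ ≤ M → ∀ᵐ x, |u x| ≤ R := by
  obtain ⟨R, hR⟩ := exists_ae_abs_le hs M.toNNReal
  exact ⟨R, fun u hu => hR _ (sobolevNorm_toL2_le_iff.2 (hu.trans (Real.le_coe_toNNReal M)))⟩

/-- The superposition operator `u ↦ f ∘ u` on `H^s`. -/
def superpositionH (hs : 0 ≤ s) (hf : ContDiff ℝ 1 f) (hf0 : f 0 = 0)
    (h : SuperpositionBound s f) (u : SobolevH s) : SobolevH s :=
  mk (superposition f (toL2 u)) <| by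
    obtain ⟨K, hK⟩ := h.exists_sobolevNorm_le hs hf hf0 ‖u‖₊
    exact (hK _ (sobolevNorm_toL2_le_iff.2 le_rfl)).trans_lt ENNReal.coe_lt_top

theorem toL2_superpositionH (hs : 0 ≤ s) (hf : ContDiff ℝ 1 f) (hf0 : f 0 = 0)
    (h : SuperpositionBound s f) (u : SobolevH s) :
    toL2 (superpositionH hs hf hf0 h u) = superposition f (toL2 u) := rfl

theorem coeFn_superpositionH (hs : 1 / 2 < s) (hs' : 0 ≤ s) (hf : ContDiff ℝ 1 f) (hf0 : f 0 = 0)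
    (h : SuperpositionBound s f) (u : SobolevH s) :
    superpositionH hs' hf hf0 h u =ᵐ[volume] fun x => f (u x) := by
  obtain ⟨R, hR⟩ := exists_ae_abs_le_of_norm_le hs ‖u‖
  exact coeFn_superposition hf hf0 (hR u le_rfl)

theorem locallyWeaklyLipschitz_superpositionH (hs : 1 / 2 < s) (hs' : 0 ≤ s)
    (hf : ContDiff ℝ 1 f) (hf0 : f 0 = 0) (h : SuperpositionBound s f) :
    LocallyWeaklyLipschitz (toL2L hs') (superpositionH hs' hf hf0 h) := by
  intro M
  obtain ⟨R, hR⟩ := exists_ae_abs_le_of_norm_le hs M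
  obtain ⟨L₂, hL₂⟩ := exists_enorm_superposition_sub_le hf hf0 R
  obtain ⟨L, hL⟩ := h M.toNNReal
  refine ⟨max L₂ L, fun u hu v hv => ?_, fun ε hε => ?_⟩
  · rw [mem_closedBall_zero_iff] at hu hv
    have hweak := hL₂ _ _ (hR u hu) (hR v hv)
    rw [← toL2_superpositionH hs' hf hf0 h, ← toL2_superpositionH hs' hf hf0 h, ← map_sub,
      ← map_sub, enorm_eq_nnnorm, enorm_eq_nnnorm] at hweak
    calc ‖toL2 (superpositionH hs' hf hf0 h u - superpositionH hs' hf hf0 h v)‖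
        ≤ L₂ * ‖toL2 (u - v)‖ := by exact_mod_cast hweak
      _ ≤ max L₂ L * ‖toL2 (u - v)‖ := by
          gcongr
          exact le_max_left _ _
  · lift ε to ℝ≥0 using hε.le
    obtain ⟨C, hC⟩ := hL ε (by exact_mod_cast hε)
    refine ⟨C, fun u hu v hv => ?_⟩
    have hball {w : SobolevH s} (hw : w ∈ Metric.closedBall 0 M) :
        sobolevNorm s (toL2 w) ≤ M.toNNReal :=
      sobolevNorm_toL2_le_iff.2 ((mem_closedBall_zero_iff.1 hw).trans (Real.le_coe_toNNReal M))
    have hstrong := hC _ _ (hball hu) (hball hv)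
    rw [← toL2_superpositionH hs' hf hf0 h, ← toL2_superpositionH hs' hf hf0 h, ← map_sub,
      ← map_sub, ← enorm_eq_sobolevNorm, ← enorm_eq_sobolevNorm, enorm_eq_nnnorm,
      enorm_eq_nnnorm, enorm_eq_nnnorm] at hstrong
    calc ‖superpositionH hs' hf hf0 h u - superpositionH hs' hf hf0 h v‖
        ≤ L * (‖u - v‖ + ε) + C * ‖toL2 (u - v)‖ := by exact_mod_cast hstrong
      _ ≤ max L₂ L * (‖u - v‖ + ε) + C * ‖toL2 (u - v)‖ := by
          gcongr
          exact le_max_right _ _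

theorem hasWeakDeriv_convolution_comp (hs : 1 / 2 < s) (hs' : 0 ≤ s) (hf : ContDiff ℝ 1 f)
    (hf0 : f 0 = 0) (h : SuperpositionBound s f) (hβ : Integrable β) (hμ : HasMeasureDeriv β μ)
    (u : SobolevH s) :
    HasWeakDeriv (β ⋆[mul ℝ ℝ, volume] fun y => f (u y))
      ((translations s).signedConv μ (superpositionH hs' hf hf0 h u)) := by
  have := completeSpace hs'
  rw [← convolution_congr _ ae_eq_rfl (coeFn_superpositionH hs hs' hf hf0 h u)]
  have hmap : toL2 ((translations s).signedConv μ (superpositionH hs' hf hf0 h u)) =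
      translationsL2.signedConv μ (toL2 (superpositionH hs' hf hf0 h u)) :=
    IsometryFamily.map_signedConv (J := toL2L hs') (τ' := translationsL2) (fun _ _ => rfl) μ _
  rw [hmap]
  exact hasWeakDeriv_convolution hβ hμ _

end SobolevH

theorem exists_wellPosedOn (hs : 0 ≤ s) {G : SobolevH s → SobolevH s}
    (hG : LocallyWeaklyLipschitz (SobolevH.toL2L hs) fun u => -G u)
    (hderiv : ∀ u : SobolevH s, HasWeakDeriv (β ⋆[mul ℝ ℝ, volume] fun y => f (u y)) (G u))
    (φ : SobolevH s) : ∃ T > 0, WellPosedOn β f T φ := by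
  have := SobolevH.completeSpace hs
  have hneg (w : SobolevH s) : (fun x => -(-w) x) =ᵐ[volume] w := by
    filter_upwards [Lp.coeFn_neg (SobolevH.toL2 w)] with x hx
    rw [map_neg, hx, Pi.neg_apply, neg_neg]
  obtain ⟨T, hT, S, hsol, huniq, hcont⟩ := hG.wellPosed SobolevH.toL2_injective φ
  have hS' {ψ} (hψ : ψ ∈ Metric.ball φ 1) {t} (ht : t ∈ Icc 0 T) :
      derivWithin (S ψ) (Icc 0 T) t = -G (S ψ t) :=
    ((hsol ψ hψ).2 t ht).derivWithin (uniqueDiffOn_Icc hT t ht)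
  refine ⟨T, hT, 1, one_pos, S, fun ψ hψ => ⟨?_, (hsol ψ hψ).1, fun t ht => ?_⟩,
    fun ψ hψ T' _ hT'T v hv => huniq ψ hψ T' hT'T v hv.initial fun t ht => ?_,
    fun ψ hψ ε hε => ?_⟩
  · refine (contDiffOn_one_iff_derivWithin (uniqueDiffOn_Icc hT)).2 ⟨fun t ht =>
      ((hsol ψ hψ).2 t ht).differentiableWithinAt, ?_⟩
    exact (hG.continuous.comp_continuousOn fun t ht =>
      ((hsol ψ hψ).2 t ht).continuousWithinAt).congr fun t ht => hS' hψ ht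
  · rw [hS' hψ ht]
    exact (hderiv _).congr_ae (hneg _).symm
  · have heq : G (v t) = -derivWithin v (Icc 0 T') t :=
      SobolevH.toL2_injective (Lp.ext (((hderiv (v t)).ae_eq (hv.equation t ht)).trans (by
        simpa using hneg (-derivWithin v (Icc 0 T') t))))
    simpa only [heq, neg_neg] using
      (hv.contDiffOn.differentiableOn one_ne_zero t ht).hasDerivWithinAt
  · obtain ⟨δ, hδ, hclose⟩ := hcont ε hε
    refine ⟨δ, hδ, fun χ hχ hχψ t ht => ?_⟩
    rw [hS' hχ ht, hS' hψ ht]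
    exact hclose χ hχ ψ hψ hχψ t

end Evolution

theorem theorem2p1 (β : ℝ → ℝ) (hβ : Integrable β)
    (hβ' : ∃ μ : SignedMeasure ℝ, HasMeasureDeriv β μ)
    (s : ℝ) (hs : 1 / 2 < s)
    (f : ℝ → ℝ) (hf : ContDiff ℝ ((⌊s⌋₊ + 1 : ℕ) : WithTop ℕ∞) f) (hf0 : f 0 = 0)
    (φ : SobolevH s) :
    ∃ T > 0, WellPosedOn β f T φ := by
  obtain ⟨μ, hμ⟩ := hβ'
  have hs' : 0 ≤ s := by linarith
  have hf1 : ContDiff ℝ 1 f := hf.of_le (by norm_cast; omega)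
  have hbound : SuperpositionBound s f :=
    superpositionBound _ hs (Nat.lt_floor_add_one s) (by exact_mod_cast hf) hf0
  have hcomplete := SobolevH.completeSpace hs'
  have hLip := (SobolevH.locallyWeaklyLipschitz_superpositionH hs hs' hf1 hf0 hbound).comp_left
    (A := -(SobolevH.translations s).signedConv μ) (B := -translationsL2.signedConv μ)
    fun u => (map_neg _ _).trans
      (congrArg Neg.neg (IsometryFamily.map_signedConv (fun _ _ => rfl) μ u))
  exact exists_wellPosedOn hs' hLip
    (SobolevH.hasWeakDeriv_convolution_comp hs hs' hf1 hf0 hbound hβ hμ) φ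

end
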